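/- Let $\Bbbk$ be an algebraically closed field and let $\mathcal C$ be a finite ribbon category over $\Bbbk$: a $\Bbbk$-linear category equivalent to the category of finite-dimensional modules over a finite-dimensional $\Bbbk$-algebra, with a ribbon structure (braiding $c$, twist $\theta$, duals $X^*$ with evaluations $\overleftarrow{\mathrm{ev}}_X:X^*\otimes X\to\mathbf 1$, $\overrightarrow{\mathrm{ev}}_X=\overleftarrow{\mathrm{ev}}_X\circ c_{X,X^*}\circ(\theta_X\otimes\mathrm{id}):X\otimes X^*\to\mathbf 1$ and coevaluation $\overleftarrow{\mathrm{coev}}_X:\mathbf 1\to X\otimes X^*$), bilinear tensor product and simple tensor unit $\mathbf 1$. Assume $\mathcal C$ is unimodular, i.e. the projective cover of $\mathbf 1$ is self-dual. We suppress coherence isomorphisms, including $X\cong X^{**}$ and $Y^*\otimes X^*\cong(X\otimes Y)^*$. Let $L=\int^{X}X^*\otimes X$, with structure morphisms $i_X:X^*\otimes X\to L$, and $E=\int_X X\otimes X^*$, with structure morphisms $j_X:E\to X\otimes X^*$. Define morphisms $\mu:L\otimes L\to L$, $\eta:\mathbf 1\to L$, $\Delta:L\to L\otimes L$, $\varepsilon:L\to\mathbf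 1$, $S:L\to L$, $\omega:L\otimes L\to\mathbf 1$ by $$\mu(i_X\otimes i_Y)=i_{Y\otimes X}(\mathrm{id}_{X^*}\otimes c_{X,Y^*\otimes Y}),\quad \eta=i_{\mathbf 1},\quad \Delta i_X=(i_X\otimes i_X)(\mathrm{id}\otimes\overleftarrow{\mathrm{coev}}_X\otimes\mathrm{id}),\quad \varepsilon i_X=\overleftarrow{\mathrm{ev}}_X,$$ $$S\,i_X=i_{X^*}\,c_{X^*,X}(\mathrm{id}\otimes\theta_X),\qquad \omega(i_X\otimes i_Y)=(\overleftarrow{\mathrm{ev}}_X\otimes\overleftarrow{\mathrm{ev}}_Y)(\mathrm{id}_{X^*}\otimes c_{Y^*,X}c_{X,Y^*}\otimes\mathrm{id}_Y),$$ and put $\tilde\omega=\omega(\mathrm{id}\otimes S)$. Let $D:L\to E$ (the Drinfeld map) and $\tilde\ell:L\to E^*$ be determined by $$j_Y D\, i_X=(\overleftarrow{\mathrm{ev}}_X\otimes\mathrm{id}_{Y\otimes Y^*})(\mathrm{id}_{X^*}\otimes c_{Y,X}c_{X,Y}\otimes\mathrm{id}_{Y^*})(\mathrm{id}_{X^*\otimes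 X}\otimes\overleftarrow{\mathrm{coev}}_Y),\qquad \tilde\ell\, i_X=(j_{X^*})^*.$$ Let $\Lambda:\mathbf 1\to L$ be an integral ($\mu(\Lambda\otimes\mathrm{id}_L)=\Lambda\varepsilon$) and $\Lambda^{\mathrm{co}}:L\to\mathbf 1$ a cointegral ($(\Lambda^{\mathrm{co}}\otimes\mathrm{id}_L)\Delta=\eta\Lambda^{\mathrm{co}}$) with $\Lambda^{\mathrm{co}}\circ\Lambda=\mathrm{id}_{\mathbf 1}$. A modularity parameter of $\Lambda$ is a scalar $\zeta\in\Bbbk^*$ with $\omega(\Lambda\otimes\mathrm{id}_L)=\zeta\Lambda^{\mathrm{co}}$. Define $\tilde D:E\to L$ by $$\tilde D=\bigl(\mathrm{id}_L\otimes\tilde\omega\otimes(\overleftarrow{\mathrm{ev}}_E(\tilde\ell\otimes\mathrm{id}_E))\bigr)\circ\bigl((\Delta\Lambda)\otimes(\Delta\Lambda)\otimes\mathrm{id}_E\bigr).$$ Then $\tilde D\circ D=\zeta\,\mathrm{id}_L$ for every modularity parameter $\zeta$ of $\Lambda$. Moreover, if $\omega$ is non-degenerate (i.e. $(\omega\otimes\mathrm{id}_{L^*})(\mathrm{id}_L\otimes\overleftarrow{\mathrm{coev}}_L):L\to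 L^*$ is an isomorphism, i.e. $\mathcal C$ is modular), then $\Lambda$ has exactly one modularity parameter. -/

import Mathlib

open CategoryTheory MonoidalCategory Limits Opposite

universe w v u

namespace RibbonCoend

noncomputable section

/-! ### Finite ribbon categories -/

/-- A `k`-linear category is finite if it is equivalent, as a `k`-linear category, to the category
of finite-dimensional modules over a finite-dimensional `k`-algebra `A`.  (Over such an `A`,
finitely generated modules are the same as finite-dimensional ones.) -/
def IsFiniteLinear (k : Type w) [Field k] (C : Type u) [Category.{v} C] [Preadditive C]
    [Linear k C] : Prop :=
  ∃ (A : Type w) (_ : Ring A) (_ : Algebra k A) (_ : Module.Finite k A)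
    (e : C ≌ FGModuleCat.{w} A) (_ : e.functor.Additive), e.functor.Linear k

/-- A ribbon category: a braided category with duals `X ↦ Xᘁ` (with evaluation `Xᘁ ⊗ X ⟶ 𝟙_ C` and
coevaluation `𝟙_ C ⟶ X ⊗ Xᘁ`), together with a twist `θ`, i.e. a natural automorphism of the
identity functor such that `θ_{X ⊗ Y} = c_{Y,X} ∘ c_{X,Y} ∘ (θ_X ⊗ θ_Y)` and `θ_{X^*} = (θ_X)^*`. -/
class RibbonCategory (C : Type u) [Category.{v} C] [MonoidalCategory C] [BraidedCategory C]
    [RightRigidCategory C] where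
  twist : ∀ X : C, X ≅ X
  twist_naturality : ∀ {X Y : C} (f : X ⟶ Y), f ≫ (twist Y).hom = (twist X).hom ≫ f
  twist_tensor : ∀ X Y : C, (twist (X ⊗ Y)).hom =
    ((twist X).hom ⊗ₘ (twist Y).hom) ≫ (β_ X Y).hom ≫ (β_ Y X).hom
  twist_dual : ∀ X : C, (twist (Xᘁ)).hom = ((twist X).hom)ᘁ

/-- `p : P ⟶ X` is a projective cover: `P` is projective and `p` is an essential epimorphism. -/
def IsProjectiveCover {C : Type u} [Category.{v} C] {P X : C} (p : P ⟶ X) : Prop :=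
  Projective P ∧ Epi p ∧ ∀ ⦃Q : C⦄ (g : Q ⟶ P), Epi (g ≫ p) → Epi g

/-- Unimodularity: the projective cover of the tensor unit is self-dual. -/
def IsUnimodular (C : Type u) [Category.{v} C] [MonoidalCategory C] [RightRigidCategory C] : Prop :=
  ∃ (P : C) (p : P ⟶ 𝟙_ C), IsProjectiveCover p ∧ Nonempty (Pᘁ ≅ P)

section Rigid

variable {C : Type u} [Category.{v} C] [MonoidalCategory C] [RightRigidCategory C]

/-- The chosen dual `X^*`. -/
abbrev dual (X : C) : C := Xᘁ

/-- The dual (transposed) morphism `f^*`. -/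
abbrev dualMap {X Y : C} (f : X ⟶ Y) : dual Y ⟶ dual X := fᘁ

/-- The left evaluation `X^* ⊗ X ⟶ 𝟙`. -/
abbrev ev (X : C) : dual X ⊗ X ⟶ 𝟙_ C := ε_ X (Xᘁ)

/-- The left coevaluation `𝟙 ⟶ X ⊗ X^*`. -/
abbrev coev (X : C) : 𝟙_ C ⟶ X ⊗ dual X := η_ X (Xᘁ)

lemma dualMap_id (X : C) : dualMap (𝟙 X) = 𝟙 (dual X) := rightAdjointMate_id

lemma dualMap_ev {X Y : C} (f : X ⟶ Y) :
    dualMap f ▷ X ≫ ev X = dual Y ◁ f ≫ ev Y :=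
  rightAdjointMate_comp_evaluation f

lemma coev_dualMap {X Y : C} (f : X ⟶ Y) :
    coev Y ≫ Y ◁ dualMap f = coev X ≫ f ▷ dual X :=
  coevaluation_comp_rightAdjointMate f

/-- A morphism into a dual object is determined by its pairing with the object. -/
lemma dual_hom_ext {A X : C} {f g : A ⟶ dual X} (h : f ▷ X ≫ ev X = g ▷ X ≫ ev X) : f = g := by
  have h' := congrArg (tensorRightHomEquiv A X (Xᘁ) (𝟙_ C)) h
  rw [tensorRightHomEquiv_whiskerRight_comp_evaluation,
    tensorRightHomEquiv_whiskerRight_comp_evaluation] at h'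
  simpa using h'

/-- The canonical morphism `Y^* ⊗ X^* ⟶ (X ⊗ Y)^*` (an isomorphism). -/
def dualTensor (X Y : C) : dual Y ⊗ dual X ⟶ dual (X ⊗ Y) := (rightDualTensorIso X Y).inv

lemma dualTensor_ev (X Y : C) :
    dualTensor X Y ▷ (X ⊗ Y) ≫ ev (X ⊗ Y) = ε_ (X ⊗ Y) (dual Y ⊗ dual X) := by
  have := @rightAdjointMate_comp_evaluation C _ _ (X ⊗ Y) (X ⊗ Y) inferInstance
    ⟨Yᘁ ⊗ Xᘁ⟩ (𝟙 (X ⊗ Y))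
  refine this.trans ?_
  simp

lemma ev_tensor (X Y : C) : ε_ (X ⊗ Y) (dual Y ⊗ dual X) =
    𝟙 _ ⊗≫ dual Y ◁ (ev X ▷ Y) ⊗≫ ev Y := rfl

lemma dualTensor_naturality {X X' Y Y' : C} (f : X ⟶ X') (g : Y ⟶ Y') :
    (dualMap g ⊗ₘ dualMap f) ≫ dualTensor X Y = dualTensor X' Y' ≫ dualMap (f ⊗ₘ g) := by
  apply dual_hom_ext
  rw [comp_whiskerRight, comp_whiskerRight, Category.assoc, Category.assoc, dualTensor_ev,
    dualMap_ev, ← whisker_exchange_assoc, dualTensor_ev, ev_tensor, ev_tensor]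
  calc
    _ = 𝟙 _ ⊗≫ (dualMap g ▷ (dual X' ⊗ X ⊗ Y) ≫ dual Y ◁ (dual X' ◁ f ▷ Y)) ⊗≫
          dual Y ◁ (ev X' ▷ Y) ⊗≫ ev Y := by
      have h : dual Y ◁ ((dualMap f ▷ X ≫ ev X) ▷ Y) = dual Y ◁ ((dual X' ◁ f ≫ ev X') ▷ Y) := by
        rw [dualMap_ev]
      have h' := congrArg (fun t => (dualMap g ▷ (dual X' ⊗ X ⊗ Y)) ⊗≫ t ⊗≫ ev Y) h
      refine Eq.trans ?_ ((congrArg (fun t => 𝟙 _ ⊗≫ t) h').trans ?_)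
      · rw [MonoidalCategory.tensorHom_def]; monoidal
      · monoidal
    _ = 𝟙 _ ⊗≫ dual Y' ◁ (dual X' ◁ f ▷ Y) ⊗≫
          (dualMap g ▷ ((dual X' ⊗ X') ⊗ Y) ≫ dual Y ◁ (ev X' ▷ Y)) ⊗≫ ev Y := by
      rw [← whisker_exchange]; monoidal
    _ = 𝟙 _ ⊗≫ dual Y' ◁ (dual X' ◁ f ▷ Y) ⊗≫ dual Y' ◁ (ev X' ▷ Y) ⊗≫
          (dualMap g ▷ Y ≫ ev Y) := by
      rw [← whisker_exchange]; monoidal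
    _ = 𝟙 _ ⊗≫ dual Y' ◁ (dual X' ◁ f ▷ Y) ⊗≫ dual Y' ◁ (ev X' ▷ Y ≫ 𝟙_ C ◁ g) ⊗≫ ev Y' := by
      rw [dualMap_ev]; monoidal
    _ = _ := by
      rw [← whisker_exchange, MonoidalCategory.tensorHom_def]; monoidal

variable (C) in
/-- The contravariant duality functor. -/
@[simps]
def dualFunctor : Cᵒᵖ ⥤ C where
  obj X := dual X.unop
  map f := dualMap f.unop
  map_id _ := rightAdjointMate_id
  map_comp _ _ := comp_rightAdjointMate

variable (C) in
/-- The functor `(X, Y) ↦ X^* ⊗ Y`. -/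
abbrev coendBifunctor : Cᵒᵖ ⥤ C ⥤ C := dualFunctor C ⋙ curriedTensor C

variable (C) in
/-- The functor `(X, Y) ↦ Y ⊗ X^*`. -/
abbrev endBifunctor : Cᵒᵖ ⥤ C ⥤ C := dualFunctor C ⋙ (curriedTensor C).flip

/-- The structure morphism `i_X : X^* ⊗ X ⟶ L` of a cowedge. -/
def inj (L : Cowedge (coendBifunctor C)) (X : C) : dual X ⊗ X ⟶ L.pt := L.π X

/-- The structure morphism `j_X : E ⟶ X ⊗ X^*` of a wedge. -/
def proj (E : Wedge (endBifunctor C)) (X : C) : E.pt ⟶ X ⊗ dual X := E.ι X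

lemma inj_condition (L : Cowedge (coendBifunctor C)) {X Y : C} (f : X ⟶ Y) :
    dualMap f ▷ X ≫ inj L X = dual Y ◁ f ≫ inj L Y :=
  Cowedge.condition L f

lemma proj_condition (E : Wedge (endBifunctor C)) {X Y : C} (f : X ⟶ Y) :
    proj E X ≫ f ▷ dual X = proj E Y ≫ Y ◁ dualMap f :=
  Wedge.condition E f

section UniversalProperty

variable {L : Cowedge (coendBifunctor C)} (hL : IsColimit L)
  {E : Wedge (endBifunctor C)} (hE : IsLimit E)

lemma inj_hom_ext (hL : IsColimit L) {Z : C} {f g : L.pt ⟶ Z} (h : ∀ X, inj L X ≫ f = inj L X ≫ g) : f = g :=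
  Cowedge.IsColimit.hom_ext hL h

lemma proj_hom_ext (hE : IsLimit E) {Z : C} {f g : Z ⟶ E.pt} (h : ∀ X, f ≫ proj E X = g ≫ proj E X) : f = g :=
  Wedge.IsLimit.hom_ext hE h

/-- The morphism out of the coend determined by a dinatural family. -/
def desc {Z : C} (f : ∀ X : C, dual X ⊗ X ⟶ Z)
    (hf : ∀ ⦃X Y : C⦄ (g : X ⟶ Y), dualMap g ▷ X ≫ f X = dual Y ◁ g ≫ f Y) : L.pt ⟶ Z :=
  Cowedge.IsColimit.desc hL f hf

lemma inj_desc {Z : C} (f : ∀ X : C, dual X ⊗ X ⟶ Z)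
    (hf : ∀ ⦃X Y : C⦄ (g : X ⟶ Y), dualMap g ▷ X ≫ f X = dual Y ◁ g ≫ f Y) (X : C) :
    inj L X ≫ desc hL f hf = f X :=
  Cowedge.IsColimit.π_desc hL f hf X

/-- The morphism into the end determined by a dinatural family. -/
def lift {Z : C} (f : ∀ X : C, Z ⟶ X ⊗ dual X)
    (hf : ∀ ⦃X Y : C⦄ (g : X ⟶ Y), f X ≫ g ▷ dual X = f Y ≫ Y ◁ dualMap g) : Z ⟶ E.pt :=
  Wedge.IsLimit.lift hE f hf

lemma lift_proj {Z : C} (f : ∀ X : C, Z ⟶ X ⊗ dual X)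
    (hf : ∀ ⦃X Y : C⦄ (g : X ⟶ Y), f X ≫ g ▷ dual X = f Y ≫ Y ◁ dualMap g) (X : C) :
    lift hE f hf ≫ proj E X = f X :=
  Wedge.IsLimit.lift_ι hE f hf X

/-- The morphism `L ⊗ W ⟶ Z` determined by a dinatural family `(X^* ⊗ X) ⊗ W ⟶ Z`. -/
def descTensor {W Z : C} (f : ∀ X : C, (dual X ⊗ X) ⊗ W ⟶ Z)
    (hf : ∀ ⦃X Y : C⦄ (g : X ⟶ Y), (dualMap g ▷ X) ▷ W ≫ f X = (dual Y ◁ g) ▷ W ≫ f Y) :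
    L.pt ⊗ W ⟶ Z :=
  (tensorRightHomEquiv L.pt W (dual W) Z).symm
    (desc hL (fun X => tensorRightHomEquiv (dual X ⊗ X) W (dual W) Z (f X)) (by
      intro X Y g
      apply (tensorRightHomEquiv _ W (dual W) Z).symm.injective
      rw [tensorRightHomEquiv_symm_naturality, tensorRightHomEquiv_symm_naturality,
        Equiv.symm_apply_apply, Equiv.symm_apply_apply, hf g]))

lemma inj_descTensor {W Z : C} (f : ∀ X : C, (dual X ⊗ X) ⊗ W ⟶ Z)
    (hf : ∀ ⦃X Y : C⦄ (g : X ⟶ Y), (dualMap g ▷ X) ▷ W ≫ f X = (dual Y ◁ g) ▷ W ≫ f Y) (X : C) :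
    inj L X ▷ W ≫ descTensor hL f hf = f X := by
  rw [descTensor, ← tensorRightHomEquiv_symm_naturality, inj_desc, Equiv.symm_apply_apply]

lemma inj_tensor_hom_ext (hL : IsColimit L) {W Z : C} {f g : L.pt ⊗ W ⟶ Z}
    (h : ∀ X, inj L X ▷ W ≫ f = inj L X ▷ W ≫ g) : f = g := by
  apply (tensorRightHomEquiv L.pt W (dual W) Z).injective
  apply inj_hom_ext hL
  intro X
  apply (tensorRightHomEquiv _ W (dual W) Z).symm.injective
  rw [tensorRightHomEquiv_symm_naturality, tensorRightHomEquiv_symm_naturality,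
    Equiv.symm_apply_apply, Equiv.symm_apply_apply, h X]

variable [BraidedCategory C]

/-- The morphism `L ⊗ L ⟶ Z` determined by a family `(X^* ⊗ X) ⊗ (Y^* ⊗ Y) ⟶ Z` that is dinatural
in both variables. -/
def desc₂ {Z : C} (f : ∀ X Y : C, (dual X ⊗ X) ⊗ (dual Y ⊗ Y) ⟶ Z)
    (hf₁ : ∀ ⦃X X' : C⦄ (g : X ⟶ X') (Y : C),
      (dualMap g ▷ X) ▷ (dual Y ⊗ Y) ≫ f X Y = (dual X' ◁ g) ▷ (dual Y ⊗ Y) ≫ f X' Y)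
    (hf₂ : ∀ (X : C) ⦃Y Y' : C⦄ (g : Y ⟶ Y'),
      (dual X ⊗ X) ◁ (dualMap g ▷ Y) ≫ f X Y = (dual X ⊗ X) ◁ (dual Y' ◁ g) ≫ f X Y') :
    L.pt ⊗ L.pt ⟶ Z :=
  descTensor hL
    (fun X => (β_ (dual X ⊗ X) L.pt).hom ≫
      descTensor hL (fun Y => (β_ (dual X ⊗ X) (dual Y ⊗ Y)).inv ≫ f X Y) (by
        intro Y Y' g
        rw [BraidedCategory.braiding_inv_naturality_left_assoc, hf₂ X g,
          BraidedCategory.braiding_inv_naturality_left_assoc]))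
    (by
      intro X X' g
      rw [BraidedCategory.braiding_naturality_left_assoc,
        BraidedCategory.braiding_naturality_left_assoc]
      congr 1
      apply inj_tensor_hom_ext hL
      intro Y
      rw [← whisker_exchange_assoc, ← whisker_exchange_assoc, inj_descTensor, inj_descTensor,
        BraidedCategory.braiding_inv_naturality_right_assoc,
        BraidedCategory.braiding_inv_naturality_right_assoc, hf₁ g Y])

lemma inj_desc₂ {Z : C} (f : ∀ X Y : C, (dual X ⊗ X) ⊗ (dual Y ⊗ Y) ⟶ Z)
    (hf₁ : ∀ ⦃X X' : C⦄ (g : X ⟶ X') (Y : C),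
      (dualMap g ▷ X) ▷ (dual Y ⊗ Y) ≫ f X Y = (dual X' ◁ g) ▷ (dual Y ⊗ Y) ≫ f X' Y)
    (hf₂ : ∀ (X : C) ⦃Y Y' : C⦄ (g : Y ⟶ Y'),
      (dual X ⊗ X) ◁ (dualMap g ▷ Y) ≫ f X Y = (dual X ⊗ X) ◁ (dual Y' ◁ g) ≫ f X Y') (X Y : C) :
    (inj L X ⊗ₘ inj L Y) ≫ desc₂ hL f hf₁ hf₂ = f X Y := by
  rw [MonoidalCategory.tensorHom_def', Category.assoc, desc₂, inj_descTensor,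
    BraidedCategory.braiding_naturality_right_assoc, inj_descTensor, Iso.hom_inv_id_assoc]

lemma inj_tensor_inj_hom_ext (hL : IsColimit L) {Z : C} {f g : L.pt ⊗ L.pt ⟶ Z}
    (h : ∀ X Y, (inj L X ⊗ₘ inj L Y) ≫ f = (inj L X ⊗ₘ inj L Y) ≫ g) : f = g := by
  apply inj_tensor_hom_ext hL
  intro X
  rw [← cancel_epi (β_ (dual X ⊗ X) L.pt).inv]
  apply inj_tensor_hom_ext hL
  intro Y
  rw [BraidedCategory.braiding_inv_naturality_left_assoc,
    BraidedCategory.braiding_inv_naturality_left_assoc, ← MonoidalCategory.tensorHom_def'_assoc,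
    ← MonoidalCategory.tensorHom_def'_assoc, h]

end UniversalProperty

end Rigid

/-! ### The right duality and the pivotal structure of a ribbon category -/

section Ribbon

variable {C : Type u} [Category.{v} C] [MonoidalCategory C] [BraidedCategory C]
  [RightRigidCategory C] [RibbonCategory C]

/-- The twist `θ_X : X ⟶ X`. -/
abbrev θ (X : C) : X ⟶ X := (RibbonCategory.twist X).hom

/-- The right evaluation `X ⊗ X^* ⟶ 𝟙` of a ribbon category. -/
def rev (X : C) : X ⊗ dual X ⟶ 𝟙_ C := θ X ▷ dual X ≫ (β_ X (dual X)).hom ≫ ev X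

lemma rev_dinatural {X Y : C} (f : X ⟶ Y) : f ▷ dual Y ≫ rev Y = X ◁ dualMap f ≫ rev X := by
  rw [rev, rev, ← comp_whiskerRight_assoc, RibbonCategory.twist_naturality,
    comp_whiskerRight_assoc, whisker_exchange_assoc,
    BraidedCategory.braiding_naturality_left_assoc,
    BraidedCategory.braiding_naturality_right_assoc, dualMap_ev]

/-- The pivotal morphism `X ⟶ X^**`: the transpose of the right evaluation. -/
def pivot (X : C) : X ⟶ dual (dual X) :=
  (ρ_ X).inv ≫ X ◁ coev (dual X) ≫ (α_ _ _ _).inv ≫ rev X ▷ dual (dual X) ≫ (λ_ _).hom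

lemma pivot_ev (X : C) : pivot X ▷ dual X ≫ ev (dual X) = rev X := by
  have h : pivot X = tensorRightHomEquiv X (dual X) (dual (dual X)) (𝟙_ C) (rev X) ≫ (λ_ _).hom := by
    simp [pivot, tensorRightHomEquiv]
  apply (tensorRightHomEquiv _ (dual X) (dual (dual X)) _).injective
  rw [tensorRightHomEquiv_whiskerRight_comp_evaluation, h]
  simp

lemma pivot_naturality {X Y : C} (f : X ⟶ Y) :
    f ≫ pivot Y = pivot X ≫ dualMap (dualMap f) := by
  apply dual_hom_ext
  rw [comp_whiskerRight, comp_whiskerRight, Category.assoc, Category.assoc, pivot_ev, dualMap_ev,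
    ← whisker_exchange_assoc, pivot_ev, rev_dinatural]

end Ribbon

/-! ### The braided Hopf algebra structure of the coend -/

section Hopf

variable {C : Type u} [Category.{v} C] [MonoidalCategory C] [BraidedCategory C]
  [RightRigidCategory C]

/-- `(X^* ⊗ X) ⊗ (Y^* ⊗ Y) ⟶ X^* ⊗ Y^* ⊗ Y ⊗ X ⟶ (Y ⊗ X)^* ⊗ (Y ⊗ X)`, where the strand `X` is
braided past `Y^* ⊗ Y`. -/
def mulFamily (X Y : C) : (dual X ⊗ X) ⊗ (dual Y ⊗ Y) ⟶ dual (Y ⊗ X) ⊗ (Y ⊗ X) :=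
  𝟙 _ ⊗≫ dual X ◁ (β_ X (dual Y ⊗ Y)).hom ⊗≫ dualTensor Y X ▷ (Y ⊗ X)

/-- `X^* ⊗ (X ⊗ Y^*) ⊗ Y ⟶ X^* ⊗ (X ⊗ Y^*) ⊗ Y ⟶ 𝟙`: double braiding of the two middle factors
followed by the two evaluations. -/
def pairingFamily (X Y : C) : (dual X ⊗ X) ⊗ (dual Y ⊗ Y) ⟶ 𝟙_ C :=
  𝟙 _ ⊗≫ dual X ◁ ((β_ X (dual Y)).hom ≫ (β_ (dual Y) X).hom) ▷ Y ⊗≫ (ev X ⊗ₘ ev Y) ≫ (λ_ _).hom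

/-- `X^* ⊗ X ⟶ Y ⊗ Y^*`: the coevaluation of `Y` is created on the right, `X` and `Y` are braided
twice, and `X^* ⊗ X` is evaluated. -/
def drinfeldFamily (X Y : C) : dual X ⊗ X ⟶ Y ⊗ dual Y :=
  𝟙 _ ⊗≫ (dual X ⊗ X) ◁ coev Y ⊗≫ dual X ◁ ((β_ X Y).hom ≫ (β_ Y X).hom) ▷ dual Y ⊗≫
    ev X ▷ (Y ⊗ dual Y) ⊗≫ 𝟙 _

/-- `X^* ⊗ X ⟶ X^* ⊗ (X ⊗ X^*) ⊗ X`. -/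
def comulFamily (X : C) : dual X ⊗ X ⟶ (dual X ⊗ X) ⊗ (dual X ⊗ X) :=
  𝟙 _ ⊗≫ dual X ◁ coev X ▷ X ⊗≫ 𝟙 _

lemma double_naturality_left {C : Type u} [Category.{v} C] [MonoidalCategory C]
    [BraidedCategory C] {X X' : C} (f : X ⟶ X') (Y : C) :
    f ▷ Y ≫ (β_ X' Y).hom ≫ (β_ Y X').hom = ((β_ X Y).hom ≫ (β_ Y X).hom) ≫ f ▷ Y := by
  simp

lemma double_naturality_right {C : Type u} [Category.{v} C] [MonoidalCategory C]
    [BraidedCategory C] (X : C) {Y Y' : C} (f : Y ⟶ Y') :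
    X ◁ f ≫ (β_ X Y').hom ≫ (β_ Y' X).hom = ((β_ X Y).hom ≫ (β_ Y X).hom) ≫ X ◁ f := by
  simp

lemma pairingFamily_dinatural₁ {X X' : C} (g : X ⟶ X') (Y : C) :
    (dualMap g ▷ X) ▷ (dual Y ⊗ Y) ≫ pairingFamily X Y =
      (dual X' ◁ g) ▷ (dual Y ⊗ Y) ≫ pairingFamily X' Y := by
  unfold pairingFamily
  calc
    _ = 𝟙 _ ⊗≫ (dualMap g ▷ (X ⊗ dual Y) ≫ dual X ◁ ((β_ X (dual Y)).hom ≫ (β_ (dual Y) X).hom)) ▷ Y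
          ⊗≫ (ev X ⊗ₘ ev Y) ≫ (λ_ _).hom := by monoidal
    _ = 𝟙 _ ⊗≫ (dual X' ◁ ((β_ X (dual Y)).hom ≫ (β_ (dual Y) X).hom)) ▷ Y
          ⊗≫ (dualMap g ▷ X ≫ ev X) ▷ (dual Y ⊗ Y) ⊗≫ ev Y := by
      rw [← whisker_exchange, MonoidalCategory.tensorHom_def]; monoidal
    _ = 𝟙 _ ⊗≫ (dual X' ◁ (((β_ X (dual Y)).hom ≫ (β_ (dual Y) X).hom) ≫ g ▷ dual Y)) ▷ Y
          ⊗≫ ev X' ▷ (dual Y ⊗ Y) ⊗≫ ev Y := by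
      rw [dualMap_ev]; monoidal
    _ = _ := by
      rw [← double_naturality_left, MonoidalCategory.tensorHom_def]; monoidal

lemma pairingFamily_dinatural₂ (X : C) {Y Y' : C} (g : Y ⟶ Y') :
    (dual X ⊗ X) ◁ (dualMap g ▷ Y) ≫ pairingFamily X Y =
      (dual X ⊗ X) ◁ (dual Y' ◁ g) ≫ pairingFamily X Y' := by
  unfold pairingFamily
  calc
    _ = 𝟙 _ ⊗≫ (dual X ◁ (X ◁ dualMap g ≫ (β_ X (dual Y)).hom ≫ (β_ (dual Y) X).hom)) ▷ Y
          ⊗≫ (ev X ⊗ₘ ev Y) ≫ (λ_ _).hom := by monoidal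
    _ = 𝟙 _ ⊗≫ (dual X ◁ ((β_ X (dual Y')).hom ≫ (β_ (dual Y') X).hom)) ▷ Y
          ⊗≫ (dual X ⊗ X) ◁ (dualMap g ▷ Y ≫ ev Y) ⊗≫ ev X := by
      rw [double_naturality_right, MonoidalCategory.tensorHom_def']; monoidal
    _ = 𝟙 _ ⊗≫ ((dual X ◁ ((β_ X (dual Y')).hom ≫ (β_ (dual Y') X).hom)) ▷ Y
          ≫ (dual X ⊗ (X ⊗ dual Y')) ◁ g) ⊗≫ (dual X ⊗ X) ◁ ev Y' ⊗≫ ev X := by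
      rw [dualMap_ev]; monoidal
    _ = _ := by
      rw [← whisker_exchange, MonoidalCategory.tensorHom_def']; monoidal

lemma drinfeldFamily_dinatural₁ {X X' : C} (g : X ⟶ X') (Y : C) :
    dualMap g ▷ X ≫ drinfeldFamily X Y = dual X' ◁ g ≫ drinfeldFamily X' Y := by
  unfold drinfeldFamily
  calc
    _ = 𝟙 _ ⊗≫ (dualMap g ▷ (X ⊗ 𝟙_ C) ≫ dual X ◁ (X ◁ coev Y)) ⊗≫
          dual X ◁ ((β_ X Y).hom ≫ (β_ Y X).hom) ▷ dual Y ⊗≫ ev X ▷ (Y ⊗ dual Y) ⊗≫ 𝟙 _ := by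
      monoidal
    _ = 𝟙 _ ⊗≫ dual X' ◁ (X ◁ coev Y) ⊗≫
          (dualMap g ▷ (X ⊗ Y) ≫ dual X ◁ ((β_ X Y).hom ≫ (β_ Y X).hom)) ▷ dual Y ⊗≫
          ev X ▷ (Y ⊗ dual Y) ⊗≫ 𝟙 _ := by
      rw [← whisker_exchange]; monoidal
    _ = 𝟙 _ ⊗≫ dual X' ◁ (X ◁ coev Y) ⊗≫
          dual X' ◁ ((β_ X Y).hom ≫ (β_ Y X).hom) ▷ dual Y ⊗≫
          (dualMap g ▷ X ≫ ev X) ▷ (Y ⊗ dual Y) ⊗≫ 𝟙 _ := by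
      rw [← whisker_exchange]; monoidal
    _ = 𝟙 _ ⊗≫ dual X' ◁ (X ◁ coev Y) ⊗≫
          dual X' ◁ (((β_ X Y).hom ≫ (β_ Y X).hom) ≫ g ▷ Y) ▷ dual Y ⊗≫
          ev X' ▷ (Y ⊗ dual Y) ⊗≫ 𝟙 _ := by
      rw [dualMap_ev]; monoidal
    _ = 𝟙 _ ⊗≫ dual X' ◁ (X ◁ coev Y ≫ g ▷ (Y ⊗ dual Y)) ⊗≫
          dual X' ◁ ((β_ X' Y).hom ≫ (β_ Y X').hom) ▷ dual Y ⊗≫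
          ev X' ▷ (Y ⊗ dual Y) ⊗≫ 𝟙 _ := by
      rw [← double_naturality_left]; monoidal
    _ = _ := by
      rw [whisker_exchange]; monoidal

lemma drinfeldFamily_dinatural₂ (X : C) {Y Y' : C} (g : Y ⟶ Y') :
    drinfeldFamily X Y ≫ g ▷ dual Y = drinfeldFamily X Y' ≫ Y' ◁ dualMap g := by
  unfold drinfeldFamily
  calc
    _ = 𝟙 _ ⊗≫ (dual X ⊗ X) ◁ coev Y ⊗≫ dual X ◁ ((β_ X Y).hom ≫ (β_ Y X).hom) ▷ dual Y ⊗≫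
          (ev X ▷ Y ≫ 𝟙_ C ◁ g) ▷ dual Y ⊗≫ 𝟙 _ := by monoidal
    _ = 𝟙 _ ⊗≫ (dual X ⊗ X) ◁ coev Y ⊗≫
          dual X ◁ (((β_ X Y).hom ≫ (β_ Y X).hom) ≫ X ◁ g) ▷ dual Y ⊗≫
          ev X ▷ (Y' ⊗ dual Y) ⊗≫ 𝟙 _ := by
      rw [← whisker_exchange]; monoidal
    _ = 𝟙 _ ⊗≫ (dual X ⊗ X) ◁ (coev Y ≫ g ▷ dual Y) ⊗≫
          dual X ◁ ((β_ X Y').hom ≫ (β_ Y' X).hom) ▷ dual Y ⊗≫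
          ev X ▷ (Y' ⊗ dual Y) ⊗≫ 𝟙 _ := by
      rw [← double_naturality_right]; monoidal
    _ = 𝟙 _ ⊗≫ (dual X ⊗ X) ◁ coev Y' ⊗≫
          dual X ◁ ((X ⊗ Y') ◁ dualMap g ≫ ((β_ X Y').hom ≫ (β_ Y' X).hom) ▷ dual Y) ⊗≫
          ev X ▷ (Y' ⊗ dual Y) ⊗≫ 𝟙 _ := by
      rw [← coev_dualMap]; monoidal
    _ = 𝟙 _ ⊗≫ (dual X ⊗ X) ◁ coev Y' ⊗≫
          dual X ◁ (((β_ X Y').hom ≫ (β_ Y' X).hom) ▷ dual Y') ⊗≫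
          ((dual X ⊗ X) ◁ (Y' ◁ dualMap g) ≫ ev X ▷ (Y' ⊗ dual Y)) ⊗≫ 𝟙 _ := by
      rw [whisker_exchange]; monoidal
    _ = _ := by
      rw [whisker_exchange]; monoidal

lemma comulFamily_dinatural (L : Cowedge (coendBifunctor C)) {X Y : C} (g : X ⟶ Y) :
    dualMap g ▷ X ≫ comulFamily X ≫ (inj L X ⊗ₘ inj L X) =
      dual Y ◁ g ≫ comulFamily Y ≫ (inj L Y ⊗ₘ inj L Y) := by
  unfold comulFamily
  calc
    _ = 𝟙 _ ⊗≫ (dualMap g ▷ 𝟙_ C ≫ dual X ◁ coev X) ▷ X ⊗≫ (inj L X ⊗ₘ inj L X) := by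
      monoidal
    _ = 𝟙 _ ⊗≫ dual Y ◁ coev X ▷ X ⊗≫
          (dualMap g ▷ X ≫ inj L X) ▷ (dual X ⊗ X) ⊗≫ L.pt ◁ inj L X := by
      rw [← whisker_exchange, MonoidalCategory.tensorHom_def]; monoidal
    _ = 𝟙 _ ⊗≫ dual Y ◁ (coev X ≫ g ▷ dual X) ▷ X ⊗≫
          inj L Y ▷ (dual X ⊗ X) ⊗≫ L.pt ◁ inj L X := by
      rw [inj_condition]; monoidal
    _ = 𝟙 _ ⊗≫ dual Y ◁ coev Y ▷ X ⊗≫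
          ((dual Y ⊗ Y) ◁ (dualMap g ▷ X) ≫ inj L Y ▷ (dual X ⊗ X)) ⊗≫ L.pt ◁ inj L X := by
      rw [← coev_dualMap]; monoidal
    _ = 𝟙 _ ⊗≫ dual Y ◁ coev Y ▷ X ⊗≫
          inj L Y ▷ (dual Y ⊗ X) ⊗≫ L.pt ◁ (dualMap g ▷ X ≫ inj L X) := by
      rw [whisker_exchange]; monoidal
    _ = 𝟙 _ ⊗≫ dual Y ◁ coev Y ▷ X ⊗≫
          (inj L Y ▷ (dual Y ⊗ X) ≫ L.pt ◁ (dual Y ◁ g)) ⊗≫ L.pt ◁ inj L Y := by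
      rw [inj_condition]; monoidal
    _ = 𝟙 _ ⊗≫ dual Y ◁ (coev Y ▷ X ≫ (Y ⊗ dual Y) ◁ g) ⊗≫
          inj L Y ▷ (dual Y ⊗ Y) ⊗≫ L.pt ◁ inj L Y := by
      rw [← whisker_exchange]; monoidal
    _ = _ := by
      rw [← whisker_exchange, MonoidalCategory.tensorHom_def]; monoidal

lemma mulFamily_dinatural₁ (L : Cowedge (coendBifunctor C)) {X X' : C} (g : X ⟶ X') (Y : C) :
    (dualMap g ▷ X) ▷ (dual Y ⊗ Y) ≫ mulFamily X Y ≫ inj L (Y ⊗ X) =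
      (dual X' ◁ g) ▷ (dual Y ⊗ Y) ≫ mulFamily X' Y ≫ inj L (Y ⊗ X') := by
  have h := dualTensor_naturality (𝟙 Y) g
  have h' := inj_condition L (Y ◁ g)
  rw [MonoidalCategory.id_tensorHom] at h
  unfold mulFamily
  calc
    _ = 𝟙 _ ⊗≫ (dualMap g ▷ (X ⊗ dual Y ⊗ Y) ≫ dual X ◁ (β_ X (dual Y ⊗ Y)).hom) ⊗≫
          dualTensor Y X ▷ (Y ⊗ X) ≫ inj L (Y ⊗ X) := by monoidal
    _ = 𝟙 _ ⊗≫ dual X' ◁ (β_ X (dual Y ⊗ Y)).hom ⊗≫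
          ((dualMap g ⊗ₘ dualMap (𝟙 Y)) ≫ dualTensor Y X) ▷ (Y ⊗ X) ≫ inj L (Y ⊗ X) := by
      rw [← whisker_exchange, dualMap, dualMap, rightAdjointMate_id, MonoidalCategory.tensorHom_id]
      monoidal
    _ = 𝟙 _ ⊗≫ dual X' ◁ (β_ X (dual Y ⊗ Y)).hom ⊗≫
          (dualTensor Y X' ▷ (Y ⊗ X) ≫ dual (Y ⊗ X') ◁ (Y ◁ g)) ≫ inj L (Y ⊗ X') := by
      rw [h, comp_whiskerRight, Category.assoc, h', Category.assoc]
    _ = 𝟙 _ ⊗≫ dual X' ◁ ((β_ X (dual Y ⊗ Y)).hom ≫ (dual Y ⊗ Y) ◁ g) ⊗≫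
          dualTensor Y X' ▷ (Y ⊗ X') ≫ inj L (Y ⊗ X') := by
      rw [← whisker_exchange]; monoidal
    _ = _ := by
      rw [← BraidedCategory.braiding_naturality_left]; monoidal

lemma mulFamily_dinatural₂ (L : Cowedge (coendBifunctor C)) (X : C) {Y Y' : C} (g : Y ⟶ Y') :
    (dual X ⊗ X) ◁ (dualMap g ▷ Y) ≫ mulFamily X Y ≫ inj L (Y ⊗ X) =
      (dual X ⊗ X) ◁ (dual Y' ◁ g) ≫ mulFamily X Y' ≫ inj L (Y' ⊗ X) := by
  have h := dualTensor_naturality g (𝟙 X)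
  have h' := inj_condition L (g ▷ X)
  rw [MonoidalCategory.tensorHom_id] at h
  unfold mulFamily
  calc
    _ = 𝟙 _ ⊗≫ dual X ◁ (X ◁ (dualMap g ▷ Y) ≫ (β_ X (dual Y ⊗ Y)).hom) ⊗≫
          dualTensor Y X ▷ (Y ⊗ X) ≫ inj L (Y ⊗ X) := by monoidal
    _ = 𝟙 _ ⊗≫ dual X ◁ (β_ X (dual Y' ⊗ Y)).hom ⊗≫
          ((dualMap (𝟙 X) ⊗ₘ dualMap g) ≫ dualTensor Y X) ▷ (Y ⊗ X) ≫ inj L (Y ⊗ X) := by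
      rw [BraidedCategory.braiding_naturality_right, dualMap, dualMap, rightAdjointMate_id,
        MonoidalCategory.id_tensorHom]
      monoidal
    _ = 𝟙 _ ⊗≫ dual X ◁ (β_ X (dual Y' ⊗ Y)).hom ⊗≫
          (dualTensor Y' X ▷ (Y ⊗ X) ≫ dual (Y' ⊗ X) ◁ (g ▷ X)) ≫ inj L (Y' ⊗ X) := by
      rw [h, comp_whiskerRight, Category.assoc, h', Category.assoc]
    _ = 𝟙 _ ⊗≫ dual X ◁ ((β_ X (dual Y' ⊗ Y)).hom ≫ (dual Y' ◁ g) ▷ X) ⊗≫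
          dualTensor Y' X ▷ (Y' ⊗ X) ≫ inj L (Y' ⊗ X) := by
      rw [← whisker_exchange]; monoidal
    _ = _ := by
      rw [← BraidedCategory.braiding_naturality_right]; monoidal

variable {L : Cowedge (coendBifunctor C)} (hL : IsColimit L)

/-- The product `μ : L ⊗ L ⟶ L`. -/
def mul : L.pt ⊗ L.pt ⟶ L.pt :=
  desc₂ hL (fun X Y => mulFamily X Y ≫ inj L (Y ⊗ X))
    (fun _ _ g Y => mulFamily_dinatural₁ L g Y) (fun X _ _ g => mulFamily_dinatural₂ L X g)

lemma inj_mul (X Y : C) :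
    (inj L X ⊗ₘ inj L Y) ≫ mul hL = mulFamily X Y ≫ inj L (Y ⊗ X) :=
  inj_desc₂ hL _ _ _ X Y

/-- The unit `η : 𝟙 ⟶ L`, i.e. `i_𝟙` composed with the canonical isomorphism `𝟙 ≅ 𝟙^* ⊗ 𝟙`. -/
def one (L : Cowedge (coendBifunctor C)) : 𝟙_ C ⟶ L.pt :=
  coev (𝟙_ C) ≫ (λ_ (dual (𝟙_ C))).hom ≫ (ρ_ (dual (𝟙_ C))).inv ≫ inj L (𝟙_ C)

/-- The coproduct `Δ : L ⟶ L ⊗ L`. -/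
def comul : L.pt ⟶ L.pt ⊗ L.pt :=
  desc hL (fun X => comulFamily X ≫ (inj L X ⊗ₘ inj L X)) (fun _ _ g => comulFamily_dinatural L g)

lemma inj_comul (X : C) :
    inj L X ≫ comul hL = comulFamily X ≫ (inj L X ⊗ₘ inj L X) :=
  inj_desc hL _ _ X

/-- The counit `ε : L ⟶ 𝟙`. -/
def counit : L.pt ⟶ 𝟙_ C := desc hL (fun X => ev X) (fun _ _ g => dualMap_ev g)

lemma inj_counit (X : C) : inj L X ≫ counit hL = ev X := inj_desc hL _ _ X

/-- The Hopf pairing `ω : L ⊗ L ⟶ 𝟙`. -/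
def pairing : L.pt ⊗ L.pt ⟶ 𝟙_ C :=
  desc₂ hL pairingFamily (fun _ _ g Y => pairingFamily_dinatural₁ g Y)
    (fun X _ _ g => pairingFamily_dinatural₂ X g)

lemma inj_pairing (X Y : C) :
    (inj L X ⊗ₘ inj L Y) ≫ pairing hL = pairingFamily X Y :=
  inj_desc₂ hL _ _ _ X Y

/-- A pairing `ω : V ⊗ V ⟶ 𝟙` is non-degenerate if the induced morphism
`(ω ⊗ id) ∘ (id ⊗ coev) : V ⟶ V^*` is an isomorphism. -/
def IsNondegenerate {V : C} (w : V ⊗ V ⟶ 𝟙_ C) : Prop :=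
  IsIso ((ρ_ V).inv ≫ V ◁ coev V ≫ (α_ V V (dual V)).inv ≫ w ▷ dual V ≫ (λ_ (dual V)).hom)

/-- (Right) integrals: `μ ∘ (Λ ⊗ id) = Λ ∘ ε`.  For unimodular finite ribbon categories left and right
integrals of the coend coincide. -/
def IsIntegral (Λ : 𝟙_ C ⟶ L.pt) : Prop :=
  Λ ▷ L.pt ≫ mul hL = (λ_ L.pt).hom ≫ counit hL ≫ Λ

/-- (Right) cointegrals: `(Λ^co ⊗ id) ∘ Δ = η ∘ Λ^co`.  Cointegrals of the coend are two-sided. -/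
def IsCointegral (Λco : L.pt ⟶ 𝟙_ C) : Prop :=
  comul hL ≫ Λco ▷ L.pt ≫ (λ_ L.pt).hom = Λco ≫ one L

/-- The scalar `ζ ∈ k^*` is the modularity parameter of `Λ` (with associated cointegral `Λ^co`) if
`ω ∘ (Λ ⊗ id) = ζ Λ^co`. -/
def IsModularityParameter {k : Type w} [Field k] [Preadditive C] [Linear k C]
    (Λ : 𝟙_ C ⟶ L.pt) (Λco : L.pt ⟶ 𝟙_ C) (ζ : k) : Prop :=
  ζ ≠ 0 ∧ (λ_ L.pt).inv ≫ Λ ▷ L.pt ≫ pairing hL = ζ • Λco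

variable {E : Wedge (endBifunctor C)} (hE : IsLimit E)

/-- The Drinfeld map `D : L ⟶ E`, characterized by `j_Y ∘ D ∘ i_X = χ_{X,Y}`. -/
def drinfeld : L.pt ⟶ E.pt :=
  desc hL (fun X => lift hE (fun Y => drinfeldFamily X Y)
      (fun _ _ g => drinfeldFamily_dinatural₂ X g)) (by
    intro X X' g
    apply proj_hom_ext hE
    intro Y
    rw [Category.assoc, Category.assoc, lift_proj, lift_proj, drinfeldFamily_dinatural₁])

lemma inj_drinfeld_proj (X Y : C) :
    inj L X ≫ drinfeld hL hE ≫ proj E Y = drinfeldFamily X Y := by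
  rw [drinfeld, ← Category.assoc, inj_desc, lift_proj]

end Hopf

section InverseDrinfeld

variable {C : Type u} [Category.{v} C] [MonoidalCategory C] [BraidedCategory C]
  [RightRigidCategory C] [RibbonCategory C]

/-- `X^* ⊗ X ⟶ X ⊗ X^* ⟶ X^** ⊗ X^*`: twist and braiding, followed by the pivotal morphism. -/
def antipodeFamily (X : C) : dual X ⊗ X ⟶ dual (dual X) ⊗ dual X :=
  dual X ◁ θ X ≫ (β_ (dual X) X).hom ≫ pivot X ▷ dual X

lemma antipodeFamily_dinatural (L : Cowedge (coendBifunctor C)) {X Y : C} (g : X ⟶ Y) :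
    dualMap g ▷ X ≫ antipodeFamily X ≫ inj L (dual X) =
      dual Y ◁ g ≫ antipodeFamily Y ≫ inj L (dual Y) := by
  unfold antipodeFamily
  simp only [Category.assoc]
  rw [← whisker_exchange_assoc, BraidedCategory.braiding_naturality_left_assoc,
    whisker_exchange_assoc, ← inj_condition, ← comp_whiskerRight_assoc (pivot X),
    ← pivot_naturality, comp_whiskerRight_assoc,
    ← BraidedCategory.braiding_naturality_right_assoc (dual Y) g, ← whiskerLeft_comp_assoc,
    ← whiskerLeft_comp_assoc, RibbonCategory.twist_naturality]

/-- `X^* ⊗ X ⟶ X^*** ⊗ X^** ⟶ (X^* ⊗ X^**)^* ⟶ E^*`, the last morphism being `(j_{X^*})^*`. -/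
def dualProjFamily (E : Wedge (endBifunctor C)) (X : C) : dual X ⊗ X ⟶ dual E.pt :=
  (pivot (dual X) ⊗ₘ pivot X) ≫ dualTensor (dual X) (dual (dual X)) ≫ dualMap (proj E (dual X))

lemma dualProjFamily_dinatural (E : Wedge (endBifunctor C)) {X Y : C} (g : X ⟶ Y) :
    dualMap g ▷ X ≫ dualProjFamily E X = dual Y ◁ g ≫ dualProjFamily E Y := by
  have h₁ := dualTensor_naturality (𝟙 (dual X)) (dualMap (dualMap g))
  have h₂ := dualTensor_naturality (dualMap g) (𝟙 (dual (dual Y)))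
  have h₃ : dualMap (dualMap g ▷ dual (dual Y)) ≫ dualMap (proj E (dual Y)) =
      dualMap (dual X ◁ dualMap (dualMap g)) ≫ dualMap (proj E (dual X)) := by
    have := congrArg (fun t => dualMap t) (proj_condition E (dualMap g))
    simpa only [dualMap, comp_rightAdjointMate] using this
  rw [dualMap_id, MonoidalCategory.tensorHom_id, MonoidalCategory.id_tensorHom] at h₁
  rw [dualMap_id, MonoidalCategory.tensorHom_id, MonoidalCategory.id_tensorHom] at h₂
  unfold dualProjFamily
  calc
    _ = ((dualMap g ≫ pivot (dual X)) ⊗ₘ pivot X) ≫ dualTensor (dual X) (dual (dual X)) ≫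
          dualMap (proj E (dual X)) := by
      simp [MonoidalCategory.tensorHom_def]
    _ = (pivot (dual Y) ⊗ₘ pivot X) ≫ (dualMap (dualMap (dualMap g)) ▷ _ ≫
          dualTensor (dual X) (dual (dual X))) ≫ dualMap (proj E (dual X)) := by
      rw [pivot_naturality, ← MonoidalCategory.tensorHom_comp_whiskerRight]; simp
    _ = (pivot (dual Y) ⊗ₘ pivot X) ≫ (dual (dual (dual Y)) ◁ dualMap (dualMap g) ≫
          dualTensor (dual Y) (dual (dual Y))) ≫ dualMap (proj E (dual Y)) := by
      rw [h₁, h₂, Category.assoc, Category.assoc, h₃]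
    _ = (pivot (dual Y) ⊗ₘ (g ≫ pivot Y)) ≫ dualTensor (dual Y) (dual (dual Y)) ≫
          dualMap (proj E (dual Y)) := by
      rw [pivot_naturality]; simp [MonoidalCategory.tensorHom_def]
    _ = _ := by simp [MonoidalCategory.tensorHom_def']

variable {L : Cowedge (coendBifunctor C)} (hL : IsColimit L)

/-- The antipode `S : L ⟶ L`. -/
def antipode : L.pt ⟶ L.pt :=
  desc hL (fun X => antipodeFamily X ≫ inj L (dual X)) (fun _ _ g => antipodeFamily_dinatural L g)

lemma inj_antipode (X : C) :
    inj L X ≫ antipode hL = antipodeFamily X ≫ inj L (dual X) :=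
  inj_desc hL _ _ X

/-- The mirrored pairing `ω ∘ (id ⊗ S)`. -/
def mirroredPairing : L.pt ⊗ L.pt ⟶ 𝟙_ C := L.pt ◁ antipode hL ≫ pairing hL

/-- The morphism `ℓ : L ⟶ E^*` induced by the duals `(j_{X^*})^*`. -/
def dualProj (E : Wedge (endBifunctor C)) : L.pt ⟶ dual E.pt :=
  desc hL (fun X => dualProjFamily E X) (fun _ _ g => dualProjFamily_dinatural E g)

lemma inj_dualProj (E : Wedge (endBifunctor C)) (X : C) :
    inj L X ≫ dualProj hL E = dualProjFamily E X :=
  inj_desc hL _ _ X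

/-- The morphism `E ⟶ L ⊗ L ⊗ L ⊗ L ⊗ E ⟶ L` obtained from two copies of `Δ ∘ Λ` by applying the
mirrored pairing to the second and third factor, and the pairing `ev_E ∘ (ℓ ⊗ id)` to the fourth
factor and `E`. -/
def drinfeldInv (E : Wedge (endBifunctor C)) (Λ : 𝟙_ C ⟶ L.pt) : E.pt ⟶ L.pt :=
  𝟙 _ ⊗≫ ((Λ ≫ comul hL) ⊗ₘ (Λ ≫ comul hL)) ▷ E.pt ⊗≫
    L.pt ◁ mirroredPairing hL ▷ (L.pt ⊗ E.pt) ⊗≫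
    L.pt ◁ (dualProj hL E ▷ E.pt ≫ ev E.pt) ⊗≫ 𝟙 _

end InverseDrinfeld

end

end RibbonCoend

/-! Write `Λ' ⊗ Λ''` for `Δ Λ`. Pairing `E` with `L` through `dualProj` turns the Drinfeld map `D`
into the Hopf pairing (`dualProj_drinfeld_ev`). Hence `D̃ ∘ D` sends `x` to `Λ'` weighted by
`linkPairing (Λ'', x)`, in which a second copy of `Δ Λ` is linked to `Λ''` by the mirrored pairing
and to `x` by `ω`. The mirrored pairing is linking by the inverse double braiding
(`antipodeFamily_pairingFamily`), so on `(A^* ⊗ A) ⊗ (X^* ⊗ X)` the two links merge into a single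
circle, coloured by the second `Λ`, around `A ⊗ X^*` (`inj_linkPairing`). Therefore `D̃ ∘ D ∘ i_X`
is `slideMap (actEndo Λ) X` fed with the first `Λ` (`comul_linkPairing`).

A morphism `L ⟶ 𝟙` amounts to a natural endomorphism of the identity functor (`endo`). The
modularity condition says that encircling by `Λ` is `ζ` times the endomorphism given by `Λ^co`
(`actEndo_app_eq_smul`). What remains is a braided analogue of the Frobenius identity for Hopf
algebras: `slideMap (endo Λco) X` fed with `Λ` is `i_X` (`IsIntegral.slideMap`). It follows by
evaluating `(Λ x') ⊗ x''` once with the integral property and once with the cointegral property.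

The same identity shows that every cointegral `f` is determined by `f ∘ Λ`
(`IsIntegral.cointegral_eq`). If `ω` is non-degenerate, `ω(Λ ⊗ -)` is a nonzero cointegral, because
`L` acts on objects by encircling. Schur's lemma for the unit then makes it a unique, nonzero
multiple of `Λ^co`. -/

namespace RibbonCoend

noncomputable section

/-! ### Double braidings and braid relations -/

section Monodromy

variable {C : Type u} [Category.{v} C] [MonoidalCategory C] [BraidedCategory C]

/-- The double braiding. -/
abbrev monodromy (X Y : C) : X ⊗ Y ⟶ X ⊗ Y := (β_ X Y).hom ≫ (β_ Y X).hom

lemma monodromy_naturality {X X' Y Y' : C} (f : X ⟶ X') (g : Y ⟶ Y') :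
    (f ⊗ₘ g) ≫ monodromy X' Y' = monodromy X Y ≫ (f ⊗ₘ g) := by
  simp

lemma monodromy_unit (X : C) : monodromy X (𝟙_ C) = 𝟙 _ := by simp [monodromy]

lemma monodromy_tensor_left (X A U : C) :
    monodromy (X ⊗ A) U = 𝟙 _ ⊗≫ X ◁ (β_ A U).hom ⊗≫ monodromy X U ▷ A ⊗≫ X ◁ (β_ U A).hom ⊗≫ 𝟙 _ := by
  rw [monodromy, BraidedCategory.braiding_tensor_left_hom, BraidedCategory.braiding_tensor_right_hom]
  monoidal

lemma monodromy_tensor_right (X Y Z : C) :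
    monodromy X (Y ⊗ Z) = 𝟙 _ ⊗≫ (β_ X Y).hom ▷ Z ⊗≫ Y ◁ monodromy X Z ⊗≫ (β_ Y X).hom ▷ Z ⊗≫ 𝟙 _ := by
  rw [monodromy, BraidedCategory.braiding_tensor_left_hom, BraidedCategory.braiding_tensor_right_hom]
  monoidal

/-- The Yang–Baxter equation. -/
lemma yangBaxter (X Y Z : C) :
    𝟙 ((X ⊗ Y) ⊗ Z) ⊗≫ (β_ X Y).hom ▷ Z ⊗≫ Y ◁ (β_ X Z).hom ⊗≫ (β_ Y Z).hom ▷ X ⊗≫ 𝟙 (Z ⊗ Y ⊗ X) =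
      𝟙 _ ⊗≫ X ◁ (β_ Y Z).hom ⊗≫ (β_ X Z).hom ▷ Y ⊗≫ Z ◁ (β_ X Y).hom ⊗≫ 𝟙 _ := by
  have := BraidedCategory.yang_baxter' X Y Z
  calc
    _ = 𝟙 _ ⊗≫ ((β_ X Y).hom ▷ Z ⊗≫ Y ◁ (β_ X Z).hom ⊗≫ (β_ Y Z).hom ▷ X) ⊗≫ 𝟙 _ := by monoidal
    _ = _ := by rw [this]; monoidal

/-- `σ₁ σ₂ σ₁² σ₂ = σ₂² σ₁ σ₂²`. -/
lemma braiding_monodromy_tensor_left (A X U : C) :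
    𝟙 (A ⊗ X ⊗ U) ⊗≫ (β_ A X).hom ▷ U ⊗≫ monodromy (X ⊗ A) U ⊗≫ 𝟙 (X ⊗ A ⊗ U) =
      𝟙 _ ⊗≫ A ◁ monodromy X U ⊗≫ (β_ A X).hom ▷ U ⊗≫ X ◁ monodromy A U ⊗≫ 𝟙 _ := by
  rw [monodromy_tensor_left]
  calc
    _ = 𝟙 _ ⊗≫ (𝟙 ((A ⊗ X) ⊗ U) ⊗≫ (β_ A X).hom ▷ U ⊗≫ X ◁ (β_ A U).hom ⊗≫ (β_ X U).hom ▷ A ⊗≫ 𝟙 (U ⊗ X ⊗ A))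
          ⊗≫ (β_ U X).hom ▷ A ⊗≫ X ◁ (β_ U A).hom ⊗≫ 𝟙 _ := by monoidal
    _ = 𝟙 _ ⊗≫ A ◁ (β_ X U).hom ⊗≫ (𝟙 ((A ⊗ U) ⊗ X) ⊗≫ (β_ A U).hom ▷ X ⊗≫ U ◁ (β_ A X).hom ⊗≫ (β_ U X).hom ▷ A ⊗≫ 𝟙 (X ⊗ U ⊗ A))
          ⊗≫ X ◁ (β_ U A).hom ⊗≫ 𝟙 _ := by rw [yangBaxter]; monoidal
    _ = _ := by rw [yangBaxter]; monoidal

/-- `σ₁² σ₂ σ₁² = σ₂ σ₁ σ₂² σ₁`. -/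
lemma monodromy_braiding_monodromy (X Y Z : C) :
    𝟙 (X ⊗ Y ⊗ Z) ⊗≫ monodromy X Y ▷ Z ⊗≫ X ◁ (β_ Y Z).hom ⊗≫ monodromy X Z ▷ Y ⊗≫ 𝟙 (X ⊗ Z ⊗ Y) =
      𝟙 _ ⊗≫ X ◁ (β_ Y Z).hom ⊗≫ monodromy X (Z ⊗ Y) ⊗≫ 𝟙 _ := by
  rw [monodromy_tensor_right]
  calc
    _ = 𝟙 _ ⊗≫ (β_ X Y).hom ▷ Z ⊗≫ (𝟙 ((Y ⊗ X) ⊗ Z) ⊗≫ (β_ Y X).hom ▷ Z ⊗≫ X ◁ (β_ Y Z).hom ⊗≫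
          (β_ X Z).hom ▷ Y ⊗≫ 𝟙 (Z ⊗ X ⊗ Y)) ⊗≫ (β_ Z X).hom ▷ Y ⊗≫ 𝟙 _ := by monoidal
    _ = 𝟙 _ ⊗≫ (𝟙 ((X ⊗ Y) ⊗ Z) ⊗≫ (β_ X Y).hom ▷ Z ⊗≫ Y ◁ (β_ X Z).hom ⊗≫ (β_ Y Z).hom ▷ X ⊗≫ 𝟙 (Z ⊗ Y ⊗ X)) ⊗≫
          Z ◁ (β_ Y X).hom ⊗≫ (β_ Z X).hom ▷ Y ⊗≫ 𝟙 _ := by rw [yangBaxter]; monoidal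
    _ = _ := by rw [yangBaxter]; monoidal

/-- A strand cannot be linked with something that ends in the unit: naturality moves the double
braiding past `f`, where it becomes a double braiding with `𝟙_ C`. -/
lemma monodromy_tensor_comp_unit (X : C) {Y Z : C} (f : Y ⊗ Z ⟶ 𝟙_ C) :
    monodromy X (Y ⊗ Z) ≫ X ◁ f = X ◁ f := by
  have := monodromy_naturality (𝟙 X) f
  rw [monodromy_unit, Category.comp_id, id_tensorHom] at this
  exact this.symm

lemma monodromy_tensor_left_comp_unit {Y Z : C} (X : C) (f : Y ⊗ Z ⟶ 𝟙_ C) :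
    monodromy (Y ⊗ Z) X ≫ f ▷ X = f ▷ X := by
  have := monodromy_naturality f (𝟙 X)
  rw [tensorHom_id] at this
  rw [← this, monodromy]; simp

end Monodromy

/-! ### Transposes of pairings, and strands crossing a cap -/

section Transpose

variable {C : Type u} [Category.{v} C] [MonoidalCategory C] [RightRigidCategory C]

/-- The morphism `Z ⟶ A^*` corresponding to a pairing `Z ⊗ A ⟶ 𝟙`. -/
def transposePairing {Z : C} (A : C) (h : Z ⊗ A ⟶ 𝟙_ C) : Z ⟶ dual A :=
  (ρ_ Z).inv ≫ Z ◁ coev A ≫ (α_ _ _ _).inv ≫ h ▷ dual A ≫ (λ_ _).hom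

lemma transposePairing_ev {Z : C} (A : C) (h : Z ⊗ A ⟶ 𝟙_ C) :
    transposePairing A h ▷ A ≫ ev A = h := by
  calc
    _ = 𝟙 _ ⊗≫ Z ◁ coev A ▷ A ⊗≫ (h ▷ (dual A ⊗ A) ≫ 𝟙_ C ◁ ev A) ⊗≫ 𝟙 _ := by
      rw [transposePairing]; monoidal
    _ = 𝟙 _ ⊗≫ Z ◁ (coev A ▷ A ⊗≫ A ◁ ev A) ⊗≫ h := by
      rw [← whisker_exchange]; monoidal
    _ = _ := by
      rw [ExactPairing.evaluation_coevaluation'']; monoidal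

end Transpose

section Evaluation

variable {C : Type u} [Category.{v} C] [MonoidalCategory C] [BraidedCategory C]
  [RightRigidCategory C]

/-- Naturality of the braiding along `ev B`, with the hexagon on the left and the trivial braiding
with the unit on the right. -/
lemma whiskerLeft_ev_eq_braiding (A B : C) :
    A ◁ ev B = 𝟙 _ ⊗≫ (β_ A (dual B)).hom ▷ B ⊗≫ dual B ◁ (β_ A B).hom ⊗≫ ev B ▷ A ⊗≫ 𝟙 _ := by
  have := BraidedCategory.braiding_naturality_right A (ev B)
  rw [BraidedCategory.braiding_tensor_right_hom, braiding_tensorUnit_right] at this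
  calc
    _ = (A ◁ ev B ≫ (ρ_ A).hom ≫ (λ_ A).inv) ⊗≫ 𝟙 _ := by monoidal
    _ = _ := by rw [this]; monoidal

/-- A strand crossing one leg of a cap crosses the other leg in the inverse way. -/
lemma braiding_ev (A B : C) :
    𝟙 (dual B ⊗ A ⊗ B) ⊗≫ dual B ◁ (β_ A B).hom ⊗≫ ev B ▷ A ⊗≫ 𝟙 A =
      𝟙 _ ⊗≫ (β_ A (dual B)).inv ▷ B ⊗≫ A ◁ ev B ⊗≫ 𝟙 _ := by
  rw [whiskerLeft_ev_eq_braiding]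
  calc
    _ = 𝟙 _ ⊗≫ ((β_ A (dual B)).inv ≫ (β_ A (dual B)).hom) ▷ B ⊗≫ dual B ◁ (β_ A B).hom ⊗≫
          ev B ▷ A ⊗≫ 𝟙 A := by rw [Iso.inv_hom_id]; monoidal
    _ = _ := by monoidal

end Evaluation

/-! ### Twist, right evaluation and the mirrored pairing -/

section Ribbon

variable {C : Type u} [Category.{v} C] [MonoidalCategory C] [BraidedCategory C]
  [RightRigidCategory C] [RibbonCategory C]

/-- The double braiding of `𝟙_ C` with itself is trivial, so the tensor axiom and naturality along
the unitor make `θ (𝟙_ C)` idempotent; it is invertible. -/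
lemma twist_unit : θ (𝟙_ C) = 𝟙 (𝟙_ C) := by
  have h := RibbonCategory.twist_tensor (𝟙_ C) (𝟙_ C)
  have h' := RibbonCategory.twist_naturality (λ_ (𝟙_ C)).hom
  have m : (β_ (𝟙_ C) (𝟙_ C)).hom ≫ (β_ (𝟙_ C) (𝟙_ C)).hom = 𝟙 _ := monodromy_unit _
  rw [h, m, Category.comp_id, MonoidalCategory.tensorHom_def, Category.assoc, leftUnitor_naturality, unitors_equal,
    rightUnitor_naturality_assoc, cancel_epi] at h'
  exact ((cancel_epi (θ (𝟙_ C))).1 ((Category.comp_id _).trans h')).symm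

/-- By naturality and `twist_unit`, the twist of `dual Y ⊗ Y` disappears under `ev Y`. Expanding it
by the tensor axiom gives a double braiding and two twists; the one on `dual Y` crosses the cap and
becomes a second twist on `Y`, which is the one contained in `rev Y`. -/
lemma twist_braiding_rev (Y : C) :
    dual Y ◁ θ Y ≫ (β_ (dual Y) Y).hom ≫ rev Y = ev Y := by
  have h : θ (dual Y ⊗ Y) ≫ ev Y = ev Y := by
    rw [← RibbonCategory.twist_naturality]
    exact (congrArg (ev Y ≫ ·) twist_unit).trans (Category.comp_id _)
  rw [θ, RibbonCategory.twist_tensor, RibbonCategory.twist_dual] at h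
  have e : dualMap (θ Y) ▷ Y ≫ ev Y = dual Y ◁ θ Y ≫ ev Y := dualMap_ev _
  have m := monodromy_naturality (dualMap (θ Y)) (𝟙 Y)
  have m' := monodromy_naturality (𝟙 (dual Y)) (θ Y)
  rw [tensorHom_id] at m
  rw [id_tensorHom] at m'
  calc
    _ = dual Y ◁ θ Y ≫ monodromy (dual Y) Y ≫ dual Y ◁ θ Y ≫ ev Y := by
      rw [rev, BraidedCategory.braiding_naturality_left_assoc]
      simp only [monodromy, Category.assoc]
    _ = dual Y ◁ θ Y ≫ monodromy (dual Y) Y ≫ dualMap (θ Y) ▷ Y ≫ ev Y := by rw [e]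
    _ = _ := by
      rw [← Category.assoc (monodromy _ _), ← m]
      rw [tensorHom_def'] at h
      simpa only [monodromy, Category.assoc] using h

/-- The pairing `(X^* ⊗ X) ⊗ (Y^* ⊗ Y) ⟶ 𝟙` with the inverse double braiding. -/
def mirroredFamily (X Y : C) : (dual X ⊗ X) ⊗ (dual Y ⊗ Y) ⟶ 𝟙_ C :=
  𝟙 _ ⊗≫ dual X ◁ ((β_ (dual Y) X).inv ≫ (β_ X (dual Y)).inv) ▷ Y ⊗≫ (ev X ⊗ₘ ev Y) ≫ (λ_ _).hom

/-- The two double braidings with `dual Y` and with `Y` combine into one with `Y ⊗ dual Y` by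
`monodromy_braiding_monodromy`, and `rev Y` removes it. -/
lemma monodromy_twist_braiding_monodromy_rev (X Y : C) :
    𝟙 (X ⊗ dual Y ⊗ Y) ⊗≫ monodromy X (dual Y) ▷ Y ⊗≫
      X ◁ (dual Y ◁ θ Y ≫ (β_ (dual Y) Y).hom) ⊗≫ monodromy X Y ▷ dual Y ⊗≫ X ◁ rev Y ⊗≫ 𝟙 X =
    𝟙 _ ⊗≫ X ◁ ev Y ⊗≫ 𝟙 _ := by
  calc
    _ = 𝟙 _ ⊗≫ (monodromy X (dual Y) ▷ Y ≫ (X ⊗ dual Y) ◁ θ Y) ⊗≫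
      X ◁ (β_ (dual Y) Y).hom ⊗≫ monodromy X Y ▷ dual Y ⊗≫ X ◁ rev Y ⊗≫ 𝟙 X := by monoidal
    _ = 𝟙 _ ⊗≫ X ◁ dual Y ◁ θ Y ⊗≫ (𝟙 (X ⊗ dual Y ⊗ Y) ⊗≫ monodromy X (dual Y) ▷ Y ⊗≫
      X ◁ (β_ (dual Y) Y).hom ⊗≫ monodromy X Y ▷ dual Y ⊗≫ 𝟙 (X ⊗ Y ⊗ dual Y)) ⊗≫ X ◁ rev Y ⊗≫ 𝟙 X := by
      rw [← whisker_exchange]; monoidal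
    _ = 𝟙 _ ⊗≫ X ◁ dual Y ◁ θ Y ⊗≫ X ◁ (β_ (dual Y) Y).hom ⊗≫
          (monodromy X (Y ⊗ dual Y) ≫ X ◁ rev Y) ⊗≫ 𝟙 X := by
      rw [monodromy_braiding_monodromy]; monoidal
    _ = 𝟙 _ ⊗≫ X ◁ (dual Y ◁ θ Y ≫ (β_ (dual Y) Y).hom ≫ rev Y) ⊗≫ 𝟙 X := by
      rw [monodromy_tensor_comp_unit]; monoidal
    _ = _ := by rw [twist_braiding_rev]

lemma twist_braiding_monodromy_rev (X Y : C) :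
    𝟙 (X ⊗ dual Y ⊗ Y) ⊗≫
      X ◁ (dual Y ◁ θ Y ≫ (β_ (dual Y) Y).hom) ⊗≫ monodromy X Y ▷ dual Y ⊗≫ X ◁ rev Y ⊗≫ 𝟙 X =
    𝟙 _ ⊗≫ ((β_ (dual Y) X).inv ≫ (β_ X (dual Y)).inv) ▷ Y ⊗≫ X ◁ ev Y ⊗≫ 𝟙 _ := by
  have h : ((β_ (dual Y) X).inv ≫ (β_ X (dual Y)).inv) ≫ monodromy X (dual Y) = 𝟙 _ := by simp
  calc
    _ = 𝟙 _ ⊗≫ (((β_ (dual Y) X).inv ≫ (β_ X (dual Y)).inv) ≫ monodromy X (dual Y)) ▷ Y ⊗≫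
      X ◁ (dual Y ◁ θ Y ≫ (β_ (dual Y) Y).hom) ⊗≫ monodromy X Y ▷ dual Y ⊗≫ X ◁ rev Y ⊗≫ 𝟙 X := by
      rw [h]; monoidal
    _ = 𝟙 _ ⊗≫ ((β_ (dual Y) X).inv ≫ (β_ X (dual Y)).inv) ▷ Y ⊗≫ (𝟙 (X ⊗ dual Y ⊗ Y) ⊗≫ monodromy X (dual Y) ▷ Y ⊗≫
      X ◁ (dual Y ◁ θ Y ≫ (β_ (dual Y) Y).hom) ⊗≫ monodromy X Y ▷ dual Y ⊗≫ X ◁ rev Y ⊗≫ 𝟙 X) := by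
      monoidal
    _ = _ := by rw [monodromy_twist_braiding_monodromy_rev]; monoidal

/-- The pivot in the antipode turns `ev (dual Y)` into `rev Y`; a double braiding with `Y` under
this cap is the inverse double braiding with `dual Y`. -/
lemma antipodeFamily_pairingFamily (X Y : C) :
    (dual X ⊗ X) ◁ antipodeFamily Y ≫ pairingFamily X (dual Y) = mirroredFamily X Y := by
  unfold antipodeFamily pairingFamily mirroredFamily
  have m := monodromy_naturality (𝟙 X) (pivot Y)
  rw [id_tensorHom] at m
  calc
    _ = 𝟙 _ ⊗≫ (dual X ⊗ X) ◁ (dual Y ◁ θ Y ≫ (β_ (dual Y) Y).hom) ⊗≫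
          dual X ◁ (X ◁ pivot Y ≫ monodromy X (dual (dual Y))) ▷ dual Y ⊗≫
          (ev X ⊗ₘ ev (dual Y)) ≫ (λ_ _).hom := by monoidal
    _ = 𝟙 _ ⊗≫ (dual X ⊗ X) ◁ (dual Y ◁ θ Y ≫ (β_ (dual Y) Y).hom) ⊗≫
          dual X ◁ (monodromy X Y) ▷ dual Y ⊗≫
          (dual X ⊗ X) ◁ (pivot Y ▷ dual Y ≫ ev (dual Y)) ⊗≫ ev X := by
      rw [m, tensorHom_def']; monoidal
    _ = 𝟙 _ ⊗≫ dual X ◁ (𝟙 (X ⊗ dual Y ⊗ Y) ⊗≫ X ◁ (dual Y ◁ θ Y ≫ (β_ (dual Y) Y).hom) ⊗≫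
          monodromy X Y ▷ dual Y ⊗≫ X ◁ rev Y ⊗≫ 𝟙 X) ⊗≫ ev X := by
      rw [pivot_ev]; monoidal
    _ = _ := by
      rw [twist_braiding_monodromy_rev, tensorHom_def']; monoidal

end Ribbon

/-! ### Compatibility of the Drinfeld map with the Hopf pairing -/

section Evaluation

variable {C : Type u} [Category.{v} C] [MonoidalCategory C] [BraidedCategory C]
  [RightRigidCategory C]

lemma monodromy_braiding_monodromy_ev (A X : C) :
    𝟙 (A ⊗ X ⊗ dual X) ⊗≫ monodromy A X ▷ dual X ⊗≫ A ◁ (β_ X (dual X)).hom ⊗≫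
      monodromy A (dual X) ▷ X ⊗≫ A ◁ ev X ⊗≫ 𝟙 A =
    𝟙 _ ⊗≫ A ◁ (β_ X (dual X)).hom ⊗≫ A ◁ ev X ⊗≫ 𝟙 _ := by
  calc
    _ = 𝟙 _ ⊗≫ (𝟙 (A ⊗ X ⊗ dual X) ⊗≫ monodromy A X ▷ dual X ⊗≫ A ◁ (β_ X (dual X)).hom ⊗≫
      monodromy A (dual X) ▷ X ⊗≫ 𝟙 (A ⊗ dual X ⊗ X)) ⊗≫ A ◁ ev X ⊗≫ 𝟙 A := by monoidal
    _ = 𝟙 _ ⊗≫ A ◁ (β_ X (dual X)).hom ⊗≫ (monodromy A (dual X ⊗ X) ≫ A ◁ ev X) ⊗≫ 𝟙 A := by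
      rw [monodromy_braiding_monodromy]; monoidal
    _ = _ := by rw [monodromy_tensor_comp_unit]

lemma braiding_tensor_monodromy_ev (D X : C) :
    𝟙 (D ⊗ X ⊗ dual X) ⊗≫ D ◁ (β_ X (dual X)).hom ⊗≫ (β_ D (dual X ⊗ X)).hom ⊗≫
      dual X ◁ monodromy X D ⊗≫ ev X ▷ D ⊗≫ 𝟙 D =
    𝟙 _ ⊗≫ monodromy D X ▷ dual X ⊗≫ D ◁ (β_ X (dual X)).hom ⊗≫ D ◁ ev X ⊗≫ 𝟙 _ := by
  symm
  calc
    _ = 𝟙 _ ⊗≫ (β_ D X).hom ▷ dual X ⊗≫ (𝟙 ((X ⊗ D) ⊗ dual X) ⊗≫ (β_ X D).hom ▷ dual X ⊗≫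
          D ◁ (β_ X (dual X)).hom ⊗≫ (β_ D (dual X)).hom ▷ X ⊗≫ 𝟙 (dual X ⊗ D ⊗ X)) ⊗≫
          dual X ◁ (β_ D X).hom ⊗≫ ev X ▷ D ⊗≫ 𝟙 _ := by
      rw [whiskerLeft_ev_eq_braiding]; monoidal
    _ = 𝟙 _ ⊗≫ (𝟙 ((D ⊗ X) ⊗ dual X) ⊗≫ (β_ D X).hom ▷ dual X ⊗≫ X ◁ (β_ D (dual X)).hom ⊗≫
          (β_ X (dual X)).hom ▷ D ⊗≫ 𝟙 (dual X ⊗ X ⊗ D)) ⊗≫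
          dual X ◁ monodromy X D ⊗≫ ev X ▷ D ⊗≫ 𝟙 _ := by
      rw [yangBaxter]; monoidal
    _ = _ := by
      rw [yangBaxter, BraidedCategory.braiding_tensor_right_hom]; monoidal

end Evaluation

section Ribbon

variable {C : Type u} [Category.{v} C] [MonoidalCategory C] [BraidedCategory C]
  [RightRigidCategory C] [RibbonCategory C]

lemma twist_dual_braiding_rev (Y : C) :
    θ (dual Y) ▷ Y ≫ (β_ (dual Y) Y).hom ≫ rev Y = ev Y := by
  rw [BraidedCategory.braiding_naturality_left_assoc, θ, RibbonCategory.twist_dual]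
  rw [← rev_dinatural, ← BraidedCategory.braiding_naturality_right_assoc, twist_braiding_rev]

/-- Counterpart of `monodromy_twist_braiding_monodromy_rev` with the cap on the left:
`braiding_monodromy_tensor_left` combines both links into a double braiding with `A ⊗ dual A`, which
`rev A` removes. -/
lemma twist_dual_braiding_monodromy_rev (A U : C) :
    𝟙 (dual A ⊗ A ⊗ U) ⊗≫ dual A ◁ monodromy A U ⊗≫
      (θ (dual A) ▷ A ≫ (β_ (dual A) A).hom) ▷ U ⊗≫ A ◁ monodromy (dual A) U ⊗≫ rev A ▷ U ⊗≫ 𝟙 U =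
    𝟙 _ ⊗≫ ev A ▷ U ⊗≫ 𝟙 _ := by
  calc
    _ = 𝟙 _ ⊗≫ (dual A ◁ monodromy A U ≫ θ (dual A) ▷ (A ⊗ U)) ⊗≫ (β_ (dual A) A).hom ▷ U ⊗≫
          A ◁ monodromy (dual A) U ⊗≫ rev A ▷ U ⊗≫ 𝟙 U := by monoidal
    _ = 𝟙 _ ⊗≫ θ (dual A) ▷ (A ⊗ U) ⊗≫ (𝟙 (dual A ⊗ A ⊗ U) ⊗≫ dual A ◁ monodromy A U ⊗≫
          (β_ (dual A) A).hom ▷ U ⊗≫ A ◁ monodromy (dual A) U ⊗≫ 𝟙 (A ⊗ dual A ⊗ U)) ⊗≫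
          rev A ▷ U ⊗≫ 𝟙 U := by rw [whisker_exchange]; monoidal
    _ = 𝟙 _ ⊗≫ θ (dual A) ▷ (A ⊗ U) ⊗≫ (β_ (dual A) A).hom ▷ U ⊗≫
          (monodromy (A ⊗ dual A) U ≫ rev A ▷ U) ⊗≫ 𝟙 U := by
      rw [← braiding_monodromy_tensor_left]; monoidal
    _ = 𝟙 _ ⊗≫ (θ (dual A) ▷ A ≫ (β_ (dual A) A).hom ≫ rev A) ▷ U ⊗≫ 𝟙 U := by
      rw [monodromy_tensor_left_comp_unit]; monoidal
    _ = _ := by rw [twist_dual_braiding_rev]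

lemma whiskerLeft_rev_eq_braiding {Z : C} (A : C) (w : Z ⟶ dual A) :
    A ◁ w ≫ rev A = θ A ▷ Z ≫ (β_ A Z).hom ≫ w ▷ A ≫ ev A := by
  rw [rev, whisker_exchange_assoc, BraidedCategory.braiding_naturality_right_assoc]

lemma twist_braiding_rev_eq_pairingFamily (A X : C) :
    𝟙 ((dual A ⊗ A) ⊗ (dual X ⊗ X)) ⊗≫ (θ (dual A) ▷ A ≫ (β_ (dual A) A).hom) ▷ (dual X ⊗ X) ⊗≫
      A ◁ ((β_ (dual A) (dual X ⊗ X)).hom ⊗≫ dual X ◁ monodromy X (dual A) ⊗≫ ev X ▷ dual A ⊗≫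
        𝟙 (dual A)) ⊗≫ rev A = pairingFamily A X := by
  -- Precomposition with this isomorphism supplies, on each side, the partner of the existing link:
  -- of `dual A` with `X` on the left, of `A` with `dual X` on the right. Each pair then cancels
  -- under a cap, and both sides reduce to `ev A` tensored with `ev X` after the braiding of `X` and
  -- `dual X`.
  let g : A ⊗ X ⊗ dual X ≅ A ⊗ dual X ⊗ X :=
    (α_ _ _ _).symm ≪≫ whiskerRightIso (β_ A X ≪≫ β_ X A) (dual X) ≪≫ α_ _ _ _ ≪≫
      whiskerLeftIso A (β_ X (dual X))
  have hg : g.hom = 𝟙 _ ⊗≫ monodromy A X ▷ dual X ⊗≫ A ◁ (β_ X (dual X)).hom := by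
    simp only [g, Iso.trans_hom, Iso.symm_hom, whiskerRightIso_hom, whiskerLeftIso_hom, monodromy]
    monoidal
  rw [← cancel_epi (α_ _ _ _).inv, ← cancel_epi (dual A ◁ g.hom), hg]
  trans 𝟙 _ ⊗≫ (dual A ⊗ A) ◁ (β_ X (dual X)).hom ⊗≫ (ev A ⊗ₘ ev X) ≫ (λ_ _).hom
  · calc
      _ = 𝟙 _ ⊗≫ dual A ◁ monodromy A X ▷ dual X ⊗≫ ((dual A ⊗ A) ◁ (β_ X (dual X)).hom ≫
            (θ (dual A) ▷ A ≫ (β_ (dual A) A).hom) ▷ (dual X ⊗ X)) ⊗≫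
            A ◁ ((β_ (dual A) (dual X ⊗ X)).hom ⊗≫ dual X ◁ monodromy X (dual A) ⊗≫
            ev X ▷ dual A ⊗≫ 𝟙 (dual A)) ⊗≫ rev A := by monoidal
      _ = 𝟙 _ ⊗≫ dual A ◁ monodromy A X ▷ dual X ⊗≫
            (θ (dual A) ▷ A ≫ (β_ (dual A) A).hom) ▷ (X ⊗ dual X) ⊗≫
            A ◁ (𝟙 (dual A ⊗ X ⊗ dual X) ⊗≫ dual A ◁ (β_ X (dual X)).hom ⊗≫
            (β_ (dual A) (dual X ⊗ X)).hom ⊗≫ dual X ◁ monodromy X (dual A) ⊗≫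
            ev X ▷ dual A ⊗≫ 𝟙 (dual A)) ⊗≫ rev A := by
        rw [whisker_exchange]; monoidal
      _ = 𝟙 _ ⊗≫ dual A ◁ monodromy A X ▷ dual X ⊗≫
            (θ (dual A) ▷ A ≫ (β_ (dual A) A).hom) ▷ (X ⊗ dual X) ⊗≫
            A ◁ monodromy (dual A) X ▷ dual X ⊗≫ ((A ⊗ dual A) ◁ ((β_ X (dual X)).hom ≫ ev X) ≫
            rev A ▷ 𝟙_ C) ⊗≫ 𝟙 _ := by
        rw [braiding_tensor_monodromy_ev]; monoidal
      _ = 𝟙 _ ⊗≫ (𝟙 (dual A ⊗ A ⊗ X) ⊗≫ dual A ◁ monodromy A X ⊗≫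
            (θ (dual A) ▷ A ≫ (β_ (dual A) A).hom) ▷ X ⊗≫
            A ◁ monodromy (dual A) X ⊗≫ rev A ▷ X ⊗≫ 𝟙 X) ▷ dual X ⊗≫
            ((β_ X (dual X)).hom ≫ ev X) ⊗≫ 𝟙 _ := by
        rw [whisker_exchange]; monoidal
      _ = 𝟙 _ ⊗≫ (ev A ▷ (X ⊗ dual X) ≫ _ ◁ ((β_ X (dual X)).hom ≫ ev X)) ⊗≫ 𝟙 _ := by
        rw [twist_dual_braiding_monodromy_rev]; monoidal
      _ = _ := by
        rw [← whisker_exchange, MonoidalCategory.tensorHom_def']; monoidal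
  · symm
    calc
      _ = 𝟙 _ ⊗≫ dual A ◁ (𝟙 (A ⊗ X ⊗ dual X) ⊗≫ monodromy A X ▷ dual X ⊗≫
            A ◁ (β_ X (dual X)).hom ⊗≫ monodromy A (dual X) ▷ X ⊗≫ A ◁ ev X ⊗≫ 𝟙 A) ⊗≫ ev A := by
        rw [pairingFamily, MonoidalCategory.tensorHom_def']; monoidal
      _ = _ := by
        rw [monodromy_braiding_monodromy_ev, MonoidalCategory.tensorHom_def']; monoidal

variable {L : Cowedge (coendBifunctor C)} (hL : IsColimit L)
  {E : Wedge (endBifunctor C)} (hE : IsLimit E)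

/-- The pivots turn the nested evaluations into `rev A` and `rev (dual A)`. Rewriting the latter by
twist and braiding puts a left evaluation against the coevaluation inside `drinfeldFamily`, and the
two cancel by a zigzag. -/
lemma pivot_drinfeldFamily_eq_pairingFamily (A X : C) :
    ((pivot (dual A) ⊗ₘ pivot A) ⊗ₘ drinfeldFamily X (dual A)) ≫
      ε_ (dual A ⊗ dual (dual A)) (dual (dual (dual A)) ⊗ dual (dual A)) = pairingFamily A X := by
  rw [ev_tensor]
  calc
    _ = 𝟙 _ ⊗≫ (dual A ⊗ A) ◁ drinfeldFamily X (dual A) ⊗≫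
          pivot (dual A) ▷ (A ⊗ dual A ⊗ dual (dual A)) ⊗≫
          dual (dual (dual A)) ◁ ((pivot A ▷ dual A ≫ ev (dual A)) ▷ dual (dual A)) ⊗≫
          ev (dual (dual A)) := by
      rw [MonoidalCategory.tensorHom_def', MonoidalCategory.tensorHom_def]; monoidal
    _ = 𝟙 _ ⊗≫ (dual A ⊗ A) ◁ drinfeldFamily X (dual A) ⊗≫
          (pivot (dual A) ▷ ((A ⊗ dual A) ⊗ dual (dual A)) ≫
          dual (dual (dual A)) ◁ (rev A ▷ dual (dual A))) ⊗≫
          ev (dual (dual A)) := by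
      rw [pivot_ev]; monoidal
    _ = 𝟙 _ ⊗≫ (dual A ⊗ A) ◁ drinfeldFamily X (dual A) ⊗≫ dual A ◁ (rev A ▷ dual (dual A)) ⊗≫
          (pivot (dual A) ▷ (dual (dual A)) ≫ ev (dual (dual A))) := by
      rw [← whisker_exchange]; monoidal
    _ = 𝟙 _ ⊗≫ dual A ◁ transposePairing (dual A) (𝟙 ((A ⊗ dual X ⊗ X) ⊗ dual A) ⊗≫
          A ◁ dual X ◁ monodromy X (dual A) ⊗≫ A ◁ ev X ▷ dual A ⊗≫ rev A) ≫ rev (dual A) := by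
      rw [pivot_ev, drinfeldFamily, transposePairing]; monoidal
    _ = 𝟙 _ ⊗≫ θ (dual A) ▷ (A ⊗ dual X ⊗ X) ⊗≫
          (β_ (dual A) (A ⊗ dual X ⊗ X)).hom ⊗≫ A ◁ dual X ◁ monodromy X (dual A) ⊗≫
            A ◁ ev X ▷ dual A ⊗≫ rev A := by
      rw [whiskerLeft_rev_eq_braiding, transposePairing_ev]; monoidal
    _ = _ := by
      rw [← twist_braiding_rev_eq_pairingFamily, BraidedCategory.braiding_tensor_right_hom]
      monoidal

/-- The pairing of `E` with `L` through `(j_{X^*})^*` corresponds to the Hopf pairing under the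
Drinfeld map. -/
lemma dualProj_drinfeld_ev :
    (dualProj hL E ⊗ₘ drinfeld hL hE) ≫ ev E.pt = pairing hL := by
  apply inj_tensor_inj_hom_ext hL
  intro A X
  rw [inj_pairing, tensorHom_comp_tensorHom_assoc, inj_dualProj, dualProjFamily,
    ← pivot_drinfeldFamily_eq_pairingFamily, ← dualTensor_ev, ← inj_drinfeld_proj hL hE]
  -- Moving the transpose of `j` across `ev` makes `j` act on the image of `D`, where the defining
  -- formula of `D` applies.
  rw [← Category.assoc (pivot (dual A) ⊗ₘ pivot A), ← tensorHom_comp_whiskerRight_assoc,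
    dualMap_ev, tensorHom_comp_whiskerLeft_assoc, ← tensorHom_comp_whiskerRight_assoc,
    Category.assoc]

end Ribbon

/-! ### Natural endomorphisms of the identity and functionals on the coend -/

/-- A natural endomorphism of the identity functor. -/
structure NatEndo (C : Type u) [Category.{v} C] where
  app : ∀ X : C, X ⟶ X
  naturality : ∀ {X Y : C} (f : X ⟶ Y), f ≫ app Y = app X ≫ f

section NaturalEndomorphisms

variable {C : Type u} [Category.{v} C] [MonoidalCategory C] [RightRigidCategory C]

/-- A morphism into an object is determined by its pairing with the dual object. -/
lemma hom_ext_ev {A X : C} {f g : A ⟶ X} (h : dual X ◁ f ≫ ev X = dual X ◁ g ≫ ev X) : f = g := by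
  have key : ∀ f : A ⟶ X, f = 𝟙 _ ⊗≫ coev X ▷ A ⊗≫ X ◁ (dual X ◁ f ≫ ev X) ⊗≫ 𝟙 _ := by
    intro f
    symm
    calc
      _ = 𝟙 _ ⊗≫ (coev X ▷ A ≫ (X ⊗ dual X) ◁ f) ⊗≫ X ◁ ev X ⊗≫ 𝟙 _ := by monoidal
      _ = 𝟙 _ ⊗≫ f ⊗≫ (coev X ▷ X ⊗≫ X ◁ ev X) ⊗≫ 𝟙 _ := by
        rw [← whisker_exchange]; monoidal
      _ = _ := by
        rw [ExactPairing.evaluation_coevaluation'']; monoidal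
  rw [key f, key g, h]

variable {L : Cowedge (coendBifunctor C)}

/-- The endomorphism of `X` that corresponds to a pairing `X^* ⊗ X ⟶ 𝟙`. -/
def mate {X : C} (h : dual X ⊗ X ⟶ 𝟙_ C) : X ⟶ X := 𝟙 X ⊗≫ coev X ▷ X ⊗≫ X ◁ h ⊗≫ 𝟙 X

lemma whiskerLeft_mate_ev {X : C} (h : dual X ⊗ X ⟶ 𝟙_ C) : dual X ◁ mate h ≫ ev X = h := by
  calc
    _ = 𝟙 _ ⊗≫ dual X ◁ coev X ▷ X ⊗≫ ((dual X ⊗ X) ◁ h ≫ ev X ▷ 𝟙_ C) ⊗≫ 𝟙 _ := by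
      rw [mate]; monoidal
    _ = 𝟙 _ ⊗≫ (dual X ◁ coev X ⊗≫ ev X ▷ dual X) ▷ X ⊗≫ h ⊗≫ 𝟙 _ := by
      rw [whisker_exchange]; monoidal
    _ = _ := by
      rw [ExactPairing.coevaluation_evaluation'']; monoidal

/-- The natural endomorphism of the identity functor that corresponds to a morphism `L ⟶ 𝟙`. -/
def endo (f : L.pt ⟶ 𝟙_ C) : NatEndo C where
  app X := mate (inj L X ≫ f)
  naturality {X Y} g := by
    apply hom_ext_ev
    rw [whiskerLeft_comp, Category.assoc, whiskerLeft_mate_ev, ← Category.assoc, ← inj_condition,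
      Category.assoc]
    trans dualMap g ▷ X ≫ dual X ◁ mate (inj L X ≫ f) ≫ ev X
    · rw [whiskerLeft_mate_ev]
    · rw [← whisker_exchange_assoc, dualMap_ev, ← whiskerLeft_comp_assoc]

lemma whiskerLeft_endo_ev (f : L.pt ⟶ 𝟙_ C) (X : C) :
    dual X ◁ (endo f).app X ≫ ev X = inj L X ≫ f :=
  whiskerLeft_mate_ev _

lemma dualMap_endo_ev (f : L.pt ⟶ 𝟙_ C) (X : C) :
    dualMap ((endo f).app X) ▷ X ≫ ev X = inj L X ≫ f := by
  refine (dualMap_ev _).trans (whiskerLeft_endo_ev f X)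

/-- Removing the strand `X^* ⊗ X` after acting by a natural endomorphism on `A ⊗ X^*`. -/
def partialEndo (φ : NatEndo C) (A X : C) : A ⊗ (dual X ⊗ X) ⟶ A :=
  (α_ _ _ _).inv ≫ φ.app (A ⊗ dual X) ▷ X ≫ (α_ _ _ _).hom ≫ A ◁ ev X ≫ (ρ_ A).hom

lemma partialEndo_naturality (φ : NatEndo C) {A B : C} (f : A ⟶ B) (X : C) :
    f ▷ (dual X ⊗ X) ≫ partialEndo φ B X = partialEndo φ A X ≫ f := by
  have h := φ.naturality (f ▷ dual X)
  calc
    _ = 𝟙 _ ⊗≫ (f ▷ dual X ≫ φ.app (B ⊗ dual X)) ▷ X ⊗≫ B ◁ ev X ⊗≫ 𝟙 _ := by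
      rw [partialEndo]; monoidal
    _ = 𝟙 _ ⊗≫ φ.app (A ⊗ dual X) ▷ X ⊗≫ (f ▷ (dual X ⊗ X) ≫ B ◁ ev X) ⊗≫ 𝟙 _ := by
      rw [h]; monoidal
    _ = _ := by
      rw [← whisker_exchange, partialEndo]; monoidal

/-- The morphism `L ⊗ (X^* ⊗ X) ⟶ L` acting by `φ` on the strands `A` and `X^*` of
`(A^* ⊗ A) ⊗ (X^* ⊗ X)`. -/
def slideMap (hL : IsColimit L) (φ : NatEndo C) (X : C) : L.pt ⊗ (dual X ⊗ X) ⟶ L.pt :=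
  descTensor hL (fun A => (α_ _ _ _).hom ≫ dual A ◁ partialEndo φ A X ≫ inj L A) (by
    intro A B g
    rw [associator_naturality_left_assoc, associator_naturality_middle_assoc,
      ← whisker_exchange_assoc, inj_condition, ← whiskerLeft_comp_assoc,
      ← whiskerLeft_comp_assoc, partialEndo_naturality])

lemma inj_slideMap (hL : IsColimit L) (φ : NatEndo C) (A X : C) :
    inj L A ▷ (dual X ⊗ X) ≫ slideMap hL φ X =
      (α_ _ _ _).hom ≫ dual A ◁ partialEndo φ A X ≫ inj L A :=
  inj_descTensor hL _ _ A

variable (C) in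
/-- The canonical morphism `𝟙 ⟶ 𝟙^*`. -/
def unitDual : 𝟙_ C ⟶ dual (𝟙_ C) := coev (𝟙_ C) ≫ (λ_ (dual (𝟙_ C))).hom

variable (C) in
lemma unitDual_ev : unitDual C ▷ 𝟙_ C ≫ ev (𝟙_ C) = (λ_ (𝟙_ C)).hom := by
  calc
    _ = 𝟙 _ ⊗≫ (coev (𝟙_ C) ▷ 𝟙_ C ≫ (α_ _ _ _).hom ≫ 𝟙_ C ◁ ev (𝟙_ C)) ⊗≫ 𝟙 _ := by
      rw [unitDual]; monoidal
    _ = _ := by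
      rw [ExactPairing.evaluation_coevaluation]; monoidal

lemma one_eq_unitDual (L : Cowedge (coendBifunctor C)) :
    one L = (ρ_ _).inv ≫ unitDual C ▷ 𝟙_ C ≫ inj L (𝟙_ C) := by
  rw [one, unitDual, ← rightUnitor_inv_naturality_assoc, Category.assoc]

lemma unitDual_dualTensor (X : C) :
    unitDual C ▷ dual X ≫ dualTensor X (𝟙_ C) ≫ dualMap (ρ_ X).inv = (λ_ _).hom := by
  apply dual_hom_ext
  rw [comp_whiskerRight, comp_whiskerRight, Category.assoc, Category.assoc, dualMap_ev,
    ← whisker_exchange_assoc, dualTensor_ev, ev_tensor]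
  calc
    _ = 𝟙 _ ⊗≫ (unitDual C ▷ ((dual X ⊗ X) ⊗ 𝟙_ C) ≫ dual (𝟙_ C) ◁ (ev X ▷ 𝟙_ C)) ⊗≫
          ev (𝟙_ C) := by monoidal
    _ = 𝟙 _ ⊗≫ ev X ⊗≫ (unitDual C ▷ 𝟙_ C ≫ ev (𝟙_ C)) := by
      rw [← whisker_exchange]; monoidal
    _ = _ := by
      rw [unitDual_ev]; monoidal

/-- A zigzag. For `f = 𝟙` it is a counit law; for `f` a dual map it computes the coproduct followed
by a functional. -/
lemma comulFamily_whiskerRight_ev (X : C) (f : dual X ⟶ dual X) :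
    comulFamily X ≫ (f ▷ X ≫ ev X) ▷ (dual X ⊗ X) ≫ (λ_ _).hom = f ▷ X := by
  calc
    _ = 𝟙 _ ⊗≫ (dual X ◁ coev X ≫ f ▷ (X ⊗ dual X)) ▷ X ⊗≫ (ev X ▷ dual X) ▷ X ⊗≫ 𝟙 _ := by
      rw [comulFamily]; monoidal
    _ = 𝟙 _ ⊗≫ f ▷ X ⊗≫ (dual X ◁ coev X ⊗≫ ev X ▷ dual X) ▷ X ⊗≫ 𝟙 _ := by
      rw [whisker_exchange]; monoidal
    _ = _ := by
      rw [ExactPairing.coevaluation_evaluation'']; monoidal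

end NaturalEndomorphisms

/-! ### The action of the coend by encircling -/

section Action

variable {C : Type u} [Category.{v} C] [MonoidalCategory C] [BraidedCategory C]
  [RightRigidCategory C] {L : Cowedge (coendBifunctor C)} (hL : IsColimit L)

/-- The morphism `(B^* ⊗ B) ⊗ U ⟶ U` in which `B` encircles `U`. -/
def actFamily (B U : C) : (dual B ⊗ B) ⊗ U ⟶ U :=
  𝟙 _ ⊗≫ dual B ◁ monodromy B U ⊗≫ ev B ▷ U ⊗≫ 𝟙 _

/-- The action of the coend on an object. -/
def act (U : C) : L.pt ⊗ U ⟶ U :=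
  descTensor hL (fun B => actFamily B U) (by
    intro A B g
    have m := monodromy_naturality g (𝟙 U)
    rw [tensorHom_id] at m
    unfold actFamily
    calc
      _ = 𝟙 _ ⊗≫ (dualMap g ▷ (A ⊗ U) ≫ dual A ◁ monodromy A U) ⊗≫ ev A ▷ U ⊗≫ 𝟙 _ := by monoidal
      _ = 𝟙 _ ⊗≫ dual B ◁ monodromy A U ⊗≫ (dualMap g ▷ A ≫ ev A) ▷ U ⊗≫ 𝟙 _ := by
        rw [← whisker_exchange]; monoidal
      _ = 𝟙 _ ⊗≫ dual B ◁ (monodromy A U ≫ g ▷ U) ⊗≫ ev B ▷ U ⊗≫ 𝟙 _ := by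
        rw [dualMap_ev]; monoidal
      _ = _ := by
        rw [← m]; monoidal)

lemma inj_act (B U : C) : inj L B ▷ U ≫ act hL U = actFamily B U := inj_descTensor hL _ _ B

lemma act_naturality {U V : C} (f : U ⟶ V) : L.pt ◁ f ≫ act hL V = act hL U ≫ f := by
  apply inj_tensor_hom_ext hL
  intro B
  have m := monodromy_naturality (𝟙 B) f
  rw [id_tensorHom] at m
  rw [← whisker_exchange_assoc, inj_act, ← Category.assoc, inj_act]
  unfold actFamily
  calc
    _ = 𝟙 _ ⊗≫ dual B ◁ (B ◁ f ≫ monodromy B V) ⊗≫ ev B ▷ V ⊗≫ 𝟙 _ := by monoidal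
    _ = 𝟙 _ ⊗≫ dual B ◁ monodromy B U ⊗≫ ((dual B ⊗ B) ◁ f ≫ ev B ▷ V) ⊗≫ 𝟙 _ := by
      rw [m]; monoidal
    _ = _ := by
      rw [whisker_exchange]; monoidal

/-- The natural endomorphism of the identity functor given by the action of `Λ : 𝟙 ⟶ L`. -/
def actEndo (Λ : 𝟙_ C ⟶ L.pt) : NatEndo C where
  app U := (λ_ U).inv ≫ Λ ▷ U ≫ act hL U
  naturality f := by
    rw [Category.assoc, Category.assoc, ← act_naturality, ← whisker_exchange_assoc,
      leftUnitor_inv_naturality_assoc]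

lemma actEndo_app (Λ : 𝟙_ C ⟶ L.pt) (U : C) :
    (actEndo hL Λ).app U = (λ_ U).inv ≫ Λ ▷ U ≫ act hL U := rfl

lemma whiskerLeft_inj_pairing (Y : C) :
    L.pt ◁ inj L Y ≫ pairing hL = (α_ _ _ _).inv ≫ act hL (dual Y) ▷ Y ≫ ev Y := by
  apply inj_tensor_hom_ext hL
  intro B
  rw [← MonoidalCategory.tensorHom_def_assoc, inj_pairing, associator_inv_naturality_left_assoc,
    ← comp_whiskerRight_assoc, inj_act, pairingFamily, actFamily, MonoidalCategory.tensorHom_def]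
  monoidal

/-- Here `Λ` acts on `dual Y`, while `endo` reads a functional as acting on `Y`; the discrepancy is
resolved in `actEndo_app_eq_smul`. -/
lemma inj_actEndo (Λ : 𝟙_ C ⟶ L.pt) (Y : C) :
    inj L Y ≫ (λ_ L.pt).inv ≫ Λ ▷ L.pt ≫ pairing hL =
      (actEndo hL Λ).app (dual Y) ▷ Y ≫ ev Y := by
  rw [leftUnitor_inv_naturality_assoc, whisker_exchange_assoc, whiskerLeft_inj_pairing, actEndo_app]
  monoidal

/-- The left side is `(Λco ⊗ id) ∘ Δ ∘ i_X`: a zigzag leaves the transposed endomorphism on `dual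
X`, and dinaturality of `i` moves it to `X`. -/
lemma IsCointegral.whiskerLeft_endo_inj {Λco : L.pt ⟶ 𝟙_ C} (h : IsCointegral hL Λco) (X : C) :
    dual X ◁ (endo Λco).app X ≫ inj L X = inj L X ≫ Λco ≫ one L := by
  have key : inj L X ≫ comul hL ≫ Λco ▷ L.pt ≫ (λ_ L.pt).hom =
      (comulFamily X ≫ (dualMap ((endo Λco).app X) ▷ X ≫ ev X) ▷ (dual X ⊗ X) ≫ (λ_ _).hom) ≫
        inj L X := by
    rw [dualMap_endo_ev, ← Category.assoc, inj_comul, MonoidalCategory.tensorHom_def']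
    simp only [Category.assoc, comp_whiskerRight]
    rw [← leftUnitor_naturality, whisker_exchange_assoc, whisker_exchange_assoc]
  rw [← h, key, comulFamily_whiskerRight_ev]
  exact (inj_condition L _).symm

lemma one_mul_inj (X : C) :
    one L ▷ (dual X ⊗ X) ≫ L.pt ◁ inj L X ≫ mul hL = (λ_ _).hom ≫ inj L X := by
  have hc := inj_condition L (ρ_ X).inv
  rw [one_eq_unitDual]
  simp only [comp_whiskerRight, Category.assoc]
  rw [← MonoidalCategory.tensorHom_def_assoc, inj_mul, mulFamily]
  calc
    _ = (𝟙 _ ⊗≫ (unitDual C ▷ (𝟙_ C ⊗ (dual X ⊗ X)) ≫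
          dual (𝟙_ C) ◁ (β_ (𝟙_ C) (dual X ⊗ X)).hom) ⊗≫ dualTensor X (𝟙_ C) ▷ (X ⊗ 𝟙_ C)) ≫
          inj L (X ⊗ 𝟙_ C) := by
      monoidal
    _ = 𝟙 _ ⊗≫ (unitDual C ▷ dual X ≫ dualTensor X (𝟙_ C)) ▷ X ⊗≫
          (dual (X ⊗ 𝟙_ C) ◁ (ρ_ X).inv ≫ inj L (X ⊗ 𝟙_ C)) := by
      rw [← whisker_exchange, braiding_tensorUnit_left]; monoidal
    _ = 𝟙 _ ⊗≫ (unitDual C ▷ dual X ≫ dualTensor X (𝟙_ C) ≫ dualMap (ρ_ X).inv) ▷ X ≫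
          inj L X := by
      rw [← hc]; monoidal
    _ = _ := by
      rw [unitDual_dualTensor]; monoidal

lemma whiskerLeft_one_pairing :
    L.pt ◁ one L ≫ pairing hL = (ρ_ _).hom ≫ counit hL := by
  apply inj_tensor_hom_ext hL
  intro X
  have m := monodromy_naturality (𝟙 X) (unitDual C)
  rw [id_tensorHom, monodromy_unit, Category.id_comp] at m
  rw [one_eq_unitDual, rightUnitor_naturality_assoc, inj_counit]
  simp only [whiskerLeft_comp, Category.assoc]
  rw [← whisker_exchange_assoc, ← whisker_exchange_assoc, ← MonoidalCategory.tensorHom_def_assoc,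
    inj_pairing, pairingFamily]
  calc
    _ = 𝟙 _ ⊗≫ dual X ◁ (X ◁ unitDual C ≫ monodromy X (dual (𝟙_ C))) ▷ 𝟙_ C ⊗≫
          (ev X ⊗ₘ ev (𝟙_ C)) ≫ (λ_ _).hom := by monoidal
    _ = 𝟙 _ ⊗≫ (dual X ⊗ X) ◁ (unitDual C ▷ 𝟙_ C ≫ ev (𝟙_ C)) ⊗≫ ev X := by
      rw [m, MonoidalCategory.tensorHom_def']; monoidal
    _ = _ := by
      rw [unitDual_ev]; monoidal

end Action

/-! ### Sliding over an integral and uniqueness of cointegrals -/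

section Slide

variable {C : Type u} [Category.{v} C] [MonoidalCategory C] [BraidedCategory C]
  [RightRigidCategory C] {L : Cowedge (coendBifunctor C)} (hL : IsColimit L)

lemma braiding_coev_ev (A X : C) :
    𝟙 (A ⊗ X) ⊗≫ (A ◁ coev X ⊗≫ (β_ A X).hom ▷ dual X) ▷ X ⊗≫ (X ⊗ A) ◁ ev X ⊗≫ 𝟙 (X ⊗ A) =
      (β_ A X).hom := by
  calc
    _ = 𝟙 _ ⊗≫ A ◁ coev X ▷ X ⊗≫ ((β_ A X).hom ▷ (dual X ⊗ X) ≫ (X ⊗ A) ◁ ev X) ⊗≫ 𝟙 _ := by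
      monoidal
    _ = 𝟙 _ ⊗≫ A ◁ (coev X ▷ X ⊗≫ X ◁ ev X) ⊗≫ (β_ A X).hom := by
      rw [← whisker_exchange]; monoidal
    _ = _ := by
      rw [ExactPairing.evaluation_coevaluation'']; monoidal

/-- The object `(X ⊗ A) ⊗ dual X` is reached from `A` by creating `X` and `dual X` around it, so
naturality pulls `φ` back to `A` alone; the created pair then straightens against `ev X`. -/
lemma comulFamily_mulFamily_partialEndo (φ : NatEndo C) (A X : C) :
    (dual A ⊗ A) ◁ comulFamily X ≫ (α_ _ _ _).inv ≫ mulFamily A X ▷ (dual X ⊗ X) ≫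
      (α_ _ _ _).hom ≫ dual (X ⊗ A) ◁ partialEndo φ (X ⊗ A) X =
    (dual A ◁ φ.app A) ▷ (dual X ⊗ X) ≫ mulFamily A X := by
  have n := φ.naturality (A ◁ coev X ⊗≫ (β_ A X).hom ▷ dual X)
  have hφ : φ.app (A ⊗ 𝟙_ C) = (ρ_ A).hom ≫ φ.app A ≫ (ρ_ A).inv := by
    rw [← Category.assoc, φ.naturality, Category.assoc, Iso.hom_inv_id, Category.comp_id]
  rw [hφ] at n
  calc
    _ = 𝟙 _ ⊗≫ dual A ◁ ((A ⊗ dual X) ◁ coev X ≫ (β_ A (dual X)).hom ▷ (X ⊗ dual X)) ▷ X ⊗≫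
          (dual A ⊗ dual X) ◁ (β_ A X).hom ▷ (dual X ⊗ X) ⊗≫
          (dualTensor X A ▷ ((X ⊗ A) ⊗ dual X) ≫
            dual (X ⊗ A) ◁ φ.app ((X ⊗ A) ⊗ dual X)) ▷ X ⊗≫
          dual (X ⊗ A) ◁ ((X ⊗ A) ◁ ev X) ⊗≫ 𝟙 _ := by
      rw [comulFamily, mulFamily, partialEndo, BraidedCategory.braiding_tensor_right_hom]
      monoidal
    _ = 𝟙 _ ⊗≫ dual A ◁ (β_ A (dual X)).hom ▷ X ⊗≫
          (dual A ⊗ dual X) ◁ ((A ◁ coev X ⊗≫ (β_ A X).hom ▷ dual X) ≫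
            φ.app ((X ⊗ A) ⊗ dual X)) ▷ X ⊗≫
          (dualTensor X A ▷ ((X ⊗ A) ⊗ dual X ⊗ X) ≫ dual (X ⊗ A) ◁ ((X ⊗ A) ◁ ev X)) ⊗≫ 𝟙 _ := by
      rw [← whisker_exchange (dualTensor X A), whisker_exchange (β_ A (dual X)).hom]; monoidal
    _ = 𝟙 _ ⊗≫ dual A ◁ ((β_ A (dual X)).hom ≫ dual X ◁ φ.app A) ▷ X ⊗≫
          (dual A ⊗ dual X) ◁ (𝟙 (A ⊗ X) ⊗≫ (A ◁ coev X ⊗≫ (β_ A X).hom ▷ dual X) ▷ X ⊗≫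
            (X ⊗ A) ◁ ev X ⊗≫ 𝟙 (X ⊗ A)) ⊗≫ dualTensor X A ▷ (X ⊗ A) := by
      rw [n, ← whisker_exchange]; monoidal
    _ = _ := by
      rw [braiding_coev_ev, ← BraidedCategory.braiding_naturality_left, mulFamily,
        BraidedCategory.braiding_tensor_right_hom]
      monoidal

/-- Sliding a strand over an integral. -/
lemma IsIntegral.slideMap {Λ : 𝟙_ C ⟶ L.pt} (hΛ : IsIntegral hL Λ) {Λco : L.pt ⟶ 𝟙_ C}
    (hΛco : IsCointegral hL Λco) (hnorm : Λ ≫ Λco = 𝟙 (𝟙_ C)) (X : C) :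
    (λ_ _).inv ≫ Λ ▷ (dual X ⊗ X) ≫ slideMap hL (endo Λco) X = inj L X := by
  -- `T` is the slide of `(a x') ⊗ x''`. In general it equals `Λco(a) x`, by the cointegral property
  -- (`h₁`), so at `a = Λ` it is `x` (`h₂`). At `a = Λ` the integral property also gives `Λ x' =
  -- ε(x') Λ`, so it is the slide of `Λ ⊗ x` (`h₃`).
  set T : L.pt ⊗ (dual X ⊗ X) ⟶ L.pt := L.pt ◁ comulFamily X ≫ (α_ _ _ _).inv ≫
    (L.pt ◁ inj L X ≫ mul hL) ▷ (dual X ⊗ X) ≫ RibbonCoend.slideMap hL (endo Λco) X with hT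
  have h₁ : T = (Λco ≫ one L) ▷ (dual X ⊗ X) ≫ L.pt ◁ inj L X ≫ mul hL := by
    apply inj_tensor_hom_ext hL
    intro A
    rw [hT, ← whisker_exchange_assoc, associator_inv_naturality_left_assoc,
      ← comp_whiskerRight_assoc, ← MonoidalCategory.tensorHom_def_assoc, inj_mul,
      comp_whiskerRight_assoc, inj_slideMap]
    have := comulFamily_mulFamily_partialEndo (endo Λco) A X =≫ inj L (X ⊗ A)
    simp only [Category.assoc] at this
    rw [this, ← inj_mul hL, MonoidalCategory.tensorHom_def, Category.assoc,
      ← comp_whiskerRight_assoc, hΛco.whiskerLeft_endo_inj, ← comp_whiskerRight_assoc]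
  have h₂ : Λ ▷ (dual X ⊗ X) ≫ T = (λ_ _).hom ≫ inj L X := by
    rw [h₁, ← comp_whiskerRight_assoc, reassoc_of% hnorm, one_mul_inj]
  have h₃ : Λ ▷ (dual X ⊗ X) ≫ T =
      Λ ▷ (dual X ⊗ X) ≫ RibbonCoend.slideMap hL (endo Λco) X := by
    rw [hT, ← whisker_exchange_assoc, associator_inv_naturality_left_assoc,
      ← comp_whiskerRight_assoc, ← whisker_exchange_assoc, hΛ, leftUnitor_naturality_assoc,
      ← Category.assoc (inj L X), inj_counit]
    have h := comulFamily_whiskerRight_ev X (𝟙 (dual X))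
    rw [id_whiskerRight, Category.id_comp] at h
    calc
      _ = 𝟙_ C ◁ (comulFamily X ≫ ev X ▷ (dual X ⊗ X) ≫ (λ_ _).hom) ≫ Λ ▷ (dual X ⊗ X) ≫
            RibbonCoend.slideMap hL (endo Λco) X := by monoidal
      _ = _ := by rw [h, whiskerLeft_id, Category.id_comp]
  rw [← h₃, h₂, Iso.inv_hom_id_assoc]

/-- Applying `f` to the identity `IsIntegral.slideMap` expresses `f` as a fixed functional times `f
∘ Λ`. With `f = Λco` it identifies that functional with `Λco`, a form of antipode invariance. -/
lemma IsIntegral.cointegral_eq {Λ : 𝟙_ C ⟶ L.pt} (hΛ : IsIntegral hL Λ) {Λco : L.pt ⟶ 𝟙_ C}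
    (hΛco : IsCointegral hL Λco) (hnorm : Λ ≫ Λco = 𝟙 (𝟙_ C)) {f : L.pt ⟶ 𝟙_ C}
    (hf : IsCointegral hL f) (X : C) :
    inj L X ≫ f = ((endo Λco).app (dual X) ▷ X ≫ ev X) ≫ Λ ≫ f := by
  -- Seen as `endo f`, the functional commutes with the slide by naturality; applied first instead,
  -- it collapses the `L` factor to the unit `one L`.
  have h₁ : RibbonCoend.slideMap hL (endo Λco) X ≫ f =
      (f ≫ one L) ▷ (dual X ⊗ X) ≫ RibbonCoend.slideMap hL (endo Λco) X ≫ counit hL := by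
    apply inj_tensor_hom_ext hL
    intro A
    rw [← comp_whiskerRight_assoc, ← hf.whiskerLeft_endo_inj, comp_whiskerRight_assoc,
      reassoc_of% inj_slideMap hL (endo Λco) A X, reassoc_of% inj_slideMap hL (endo Λco) A X,
      inj_counit, ← whiskerLeft_endo_ev, associator_naturality_middle_assoc,
      ← whiskerLeft_comp_assoc, ← whiskerLeft_comp_assoc, partialEndo_naturality]
  have h₂ : one L ▷ (dual X ⊗ X) ≫ RibbonCoend.slideMap hL (endo Λco) X ≫ counit hL =
      (λ_ _).hom ≫ (endo Λco).app (dual X) ▷ X ≫ ev X := by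
    have n := (endo Λco).naturality (λ_ (dual X)).inv
    rw [one_eq_unitDual]
    simp only [comp_whiskerRight, Category.assoc]
    rw [reassoc_of% inj_slideMap hL (endo Λco) (𝟙_ C) X, inj_counit]
    calc
      _ = 𝟙 _ ⊗≫ unitDual C ▷ (𝟙_ C ⊗ dual X ⊗ X) ⊗≫ dual (𝟙_ C) ◁ ((λ_ (dual X)).inv ≫
            (endo Λco).app (𝟙_ C ⊗ dual X)) ▷ X ⊗≫ dual (𝟙_ C) ◁ ev X ⊗≫ ev (𝟙_ C) := by
        rw [partialEndo]; monoidal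
      _ = 𝟙 _ ⊗≫ (unitDual C ▷ (dual X ⊗ X) ≫ dual (𝟙_ C) ◁ ((endo Λco).app (dual X) ▷ X ≫ ev X)) ⊗≫
            ev (𝟙_ C) := by
        rw [n]; monoidal
      _ = 𝟙 _ ⊗≫ ((endo Λco).app (dual X) ▷ X ≫ ev X) ⊗≫ (unitDual C ▷ 𝟙_ C ≫ ev (𝟙_ C)) := by
        rw [← whisker_exchange]; monoidal
      _ = _ := by
        rw [unitDual_ev]; monoidal
  rw [← hΛ.slideMap hL hΛco hnorm X, Category.assoc, Category.assoc, h₁, comp_whiskerRight_assoc,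
    h₂, ← comp_whiskerRight_assoc]
  generalize Λ ≫ f = s
  generalize (endo Λco).app (dual X) ▷ X ≫ ev X = g
  rw [← leftUnitor_naturality, ← whisker_exchange_assoc, unitors_equal, rightUnitor_naturality,
    ← unitors_equal, leftUnitor_naturality_assoc, Iso.inv_hom_id_assoc]

end Slide

/-! ### The action is multiplicative; integrals and non-degeneracy -/

section ActionOfProduct

variable {C : Type u} [Category.{v} C] [MonoidalCategory C] [BraidedCategory C]
  [RightRigidCategory C] {L : Cowedge (coendBifunctor C)} (hL : IsColimit L)

lemma whiskerLeft_inj_hom_ext (hL : IsColimit L) {W V Z : C} {f g : W ⊗ (L.pt ⊗ V) ⟶ Z}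
    (h : ∀ B, W ◁ (inj L B ▷ V) ≫ f = W ◁ (inj L B ▷ V) ≫ g) : f = g := by
  rw [← cancel_epi ((α_ L.pt V W).inv ≫ (β_ (L.pt ⊗ V) W).hom)]
  apply inj_tensor_hom_ext hL
  intro B
  have key : ∀ f : W ⊗ (L.pt ⊗ V) ⟶ Z, inj L B ▷ (V ⊗ W) ≫ ((α_ L.pt V W).inv ≫
      (β_ (L.pt ⊗ V) W).hom) ≫ f = (α_ _ V W).inv ≫ (β_ (_ ⊗ V) W).hom ≫
        W ◁ (inj L B ▷ V) ≫ f := by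
    intro f
    rw [Category.assoc, associator_inv_naturality_left_assoc,
      BraidedCategory.braiding_naturality_left_assoc]
  rw [key, key, h]

/-- A circle coloured by `X ⊗ A` splits into two nested circles by `braiding_monodromy_tensor_left`;
the crossings of `A` with `dual X ⊗ X` are absorbed by the cap of `X`. -/
lemma mulFamily_actFamily (A X U : C) :
    mulFamily A X ▷ U ≫ actFamily (X ⊗ A) U =
      (α_ _ _ _).hom ≫ (dual A ⊗ A) ◁ actFamily X U ≫ actFamily A U := by
  unfold mulFamily actFamily
  calc
    _ = 𝟙 _ ⊗≫ dual A ◁ (β_ A (dual X ⊗ X)).hom ▷ U ⊗≫ (dualTensor X A ▷ ((X ⊗ A) ⊗ U) ≫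
          dual (X ⊗ A) ◁ monodromy (X ⊗ A) U) ⊗≫ ev (X ⊗ A) ▷ U ⊗≫ 𝟙 _ := by monoidal
    _ = 𝟙 _ ⊗≫ dual A ◁ (β_ A (dual X)).hom ▷ (X ⊗ U) ⊗≫ (dual A ⊗ dual X) ◁
          (𝟙 (A ⊗ X ⊗ U) ⊗≫ (β_ A X).hom ▷ U ⊗≫ monodromy (X ⊗ A) U ⊗≫ 𝟙 (X ⊗ A ⊗ U)) ⊗≫
          (dualTensor X A ▷ (X ⊗ A) ≫ ev (X ⊗ A)) ▷ U ⊗≫ 𝟙 _ := by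
      rw [← whisker_exchange, BraidedCategory.braiding_tensor_right_hom]; monoidal
    _ = 𝟙 _ ⊗≫ dual A ◁ ((β_ A (dual X)).hom ▷ (X ⊗ U) ≫ (dual X ⊗ A) ◁ monodromy X U) ⊗≫
          (dual A ⊗ dual X) ◁ (β_ A X).hom ▷ U ⊗≫
          dual A ◁ ((dual X ⊗ X) ◁ monodromy A U ≫ ev X ▷ (A ⊗ U)) ⊗≫ ev A ▷ U ⊗≫ 𝟙 _ := by
      rw [braiding_monodromy_tensor_left, dualTensor_ev, ev_tensor]; monoidal
    _ = 𝟙 _ ⊗≫ (dual A ⊗ A) ◁ dual X ◁ monodromy X U ⊗≫ dual A ◁ (𝟙 (A ⊗ dual X ⊗ X) ⊗≫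
          (β_ A (dual X)).hom ▷ X ⊗≫ dual X ◁ (β_ A X).hom ⊗≫ ev X ▷ A ⊗≫ 𝟙 (A ⊗ 𝟙_ C)) ▷ U ⊗≫
          dual A ◁ monodromy A U ⊗≫ ev A ▷ U ⊗≫ 𝟙 _ := by
      rw [← whisker_exchange (β_ A (dual X)).hom, whisker_exchange (ev X)]; monoidal
    _ = _ := by
      rw [← whiskerLeft_ev_eq_braiding]; monoidal

lemma mul_act (U : C) :
    mul hL ▷ U ≫ act hL U = (α_ _ _ _).hom ≫ L.pt ◁ act hL U ≫ act hL U := by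
  rw [← cancel_epi (α_ _ _ _).inv]
  apply inj_tensor_hom_ext hL
  intro A
  apply whiskerLeft_inj_hom_ext hL
  intro X
  trans (α_ _ _ _).inv ≫ ((inj L A ⊗ₘ inj L X) ≫ mul hL) ▷ U ≫ act hL U
  · rw [MonoidalCategory.tensorHom_def']
    monoidal
  · rw [inj_mul, comp_whiskerRight_assoc, inj_act, mulFamily_actFamily, Iso.inv_hom_id_assoc,
      Iso.inv_hom_id_assoc, ← whisker_exchange_assoc, ← whiskerLeft_comp_assoc, inj_act, inj_act]

/-- Naturality of the action exchanges the order, so `a · (Λ · u)` becomes `Λ · (a · u) = (Λ a) ·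
u`, where the integral property applies. -/
lemma IsIntegral.whiskerLeft_actEndo_act {Λ : 𝟙_ C ⟶ L.pt} (hΛ : IsIntegral hL Λ) (U : C) :
    L.pt ◁ (actEndo hL Λ).app U ≫ act hL U =
      counit hL ▷ U ≫ (λ_ U).hom ≫ (actEndo hL Λ).app U := by
  rw [act_naturality, actEndo_app, leftUnitor_inv_naturality_assoc, whisker_exchange_assoc]
  have h := mul_act hL U
  rw [← Iso.inv_comp_eq] at h
  rw [← h, associator_inv_naturality_left_assoc, ← comp_whiskerRight_assoc, hΛ]
  monoidal

/-- If the Hopf pairing is non-degenerate then an integral gives a cointegral. -/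
lemma IsIntegral.isCointegral_pairing {Λ : 𝟙_ C ⟶ L.pt} (hΛ : IsIntegral hL Λ)
    (hω : IsNondegenerate (pairing hL)) :
    IsCointegral hL ((λ_ L.pt).inv ≫ Λ ▷ L.pt ≫ pairing hL) := by
  -- Non-degeneracy: a morphism into `L` is determined by its pairing with `L` from the left.
  have ext : ∀ {Z : C} {f g : Z ⟶ L.pt}, L.pt ◁ f ≫ pairing hL = L.pt ◁ g ≫ pairing hL → f = g := by
    intro Z f g hfg
    have key : ∀ f : Z ⟶ L.pt, L.pt ◁ f ≫ pairing hL =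
        transposePairing L.pt (pairing hL) ▷ Z ≫ dual L.pt ◁ f ≫ ev L.pt := by
      intro f
      rw [← whisker_exchange_assoc, transposePairing_ev]
    have : IsIso (transposePairing L.pt (pairing hL)) := hω
    rw [key, key, cancel_epi] at hfg
    exact hom_ext_ev hfg
  apply inj_hom_ext hL
  intro Y
  have h₁ : inj L Y ≫ comul hL ≫ ((λ_ L.pt).inv ≫ Λ ▷ L.pt ≫ pairing hL) ▷ L.pt ≫ (λ_ L.pt).hom =
      (actEndo hL Λ).app (dual Y) ▷ Y ≫ inj L Y := by
    rw [← comulFamily_whiskerRight_ev, ← inj_actEndo, ← Category.assoc, inj_comul,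
      MonoidalCategory.tensorHom_def']
    simp only [Category.assoc, comp_whiskerRight]
    rw [← leftUnitor_naturality]
    simp only [whisker_exchange_assoc]
  rw [h₁, ← Category.assoc, inj_actEndo]
  -- After pairing, the cointegral equation reads `a · (Λ · u) = ε(a) Λ · u` for the action on `dual
  -- Y`.
  apply ext
  rw [whiskerLeft_comp_assoc, whiskerLeft_inj_pairing, whiskerLeft_comp_assoc,
    whiskerLeft_one_pairing]
  calc
    _ = (α_ _ _ _).inv ≫ (L.pt ◁ (actEndo hL Λ).app (dual Y) ≫ act hL (dual Y)) ▷ Y ≫ ev Y := by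
      monoidal
    _ = _ := by
      rw [hΛ.whiskerLeft_actEndo_act, ← rightUnitor_naturality, whisker_exchange_assoc]
      monoidal

lemma IsNondegenerate.ne_zero [Preadditive C] [MonoidalPreadditive C] (hω : IsNondegenerate (pairing hL)) {Λ : 𝟙_ C ⟶ L.pt} (hΛ : Λ ≠ 0) :
    (λ_ L.pt).inv ≫ Λ ▷ L.pt ≫ pairing hL ≠ 0 := by
  intro h
  have : IsIso (transposePairing L.pt (pairing hL)) := hω
  rw [← transposePairing_ev L.pt (pairing hL), ← comp_whiskerRight_assoc,
    ← cancel_epi (λ_ L.pt).hom, Iso.hom_inv_id_assoc, comp_zero] at h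
  apply hΛ
  rw [← cancel_mono (transposePairing L.pt (pairing hL)), zero_comp]
  apply dual_hom_ext
  rw [h, MonoidalPreadditive.zero_whiskerRight, zero_comp]

end ActionOfProduct

/-! ### Merging two links into one circle -/

section Link

variable {C : Type u} [Category.{v} C] [MonoidalCategory C] [BraidedCategory C]
  [RightRigidCategory C]

/-- Of the crossings between the circle and `A`, those of `B` cancel in part against the inverse
braiding in front; the remaining one crosses the cap and becomes an inverse crossing with `dual B`.
-/
lemma braiding_inv_actFamily (A B X : C) :
    𝟙 (A ⊗ (dual B ⊗ B) ⊗ dual X) ⊗≫ (β_ (dual B ⊗ B) A).inv ▷ dual X ⊗≫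
      actFamily B (A ⊗ dual X) =
    𝟙 _ ⊗≫ ((β_ (dual B) A).inv ≫ (β_ A (dual B)).inv) ▷ (B ⊗ dual X) ⊗≫
      (A ⊗ dual B) ◁ monodromy B (dual X) ⊗≫ A ◁ ev B ▷ dual X ⊗≫ 𝟙 _ := by
  calc
    _ = 𝟙 _ ⊗≫ (β_ (dual B) A).inv ▷ (B ⊗ dual X) ⊗≫
          dual B ◁ ((β_ B A).inv ≫ (β_ B A).hom) ▷ dual X ⊗≫
          (dual B ⊗ A) ◁ monodromy B (dual X) ⊗≫
          (𝟙 (dual B ⊗ A ⊗ B) ⊗≫ dual B ◁ (β_ A B).hom ⊗≫ ev B ▷ A ⊗≫ 𝟙 A) ▷ dual X ⊗≫ 𝟙 _ := by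
      rw [actFamily, monodromy_tensor_right, BraidedCategory.braiding_tensor_left_inv]; monoidal
    _ = 𝟙 _ ⊗≫ (β_ (dual B) A).inv ▷ (B ⊗ dual X) ⊗≫
          ((dual B ⊗ A) ◁ monodromy B (dual X) ≫ (β_ A (dual B)).inv ▷ (B ⊗ dual X)) ⊗≫
          A ◁ ev B ▷ dual X ⊗≫ 𝟙 _ := by
      rw [braiding_ev, Iso.inv_hom_id]; monoidal
    _ = _ := by
      rw [whisker_exchange]; monoidal

/-- The coevaluation of `B` created by the coproduct straightens against the cap of the mirrored
pairing, joining its two `B`-coloured loops. -/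
lemma comulFamily_mirroredFamily_pairingFamily (A B X : C) :
    (dual A ⊗ A) ◁ (comulFamily B ▷ (dual X ⊗ X) ≫ (α_ _ _ _).hom) ≫ (α_ _ _ _).inv ≫
      (mirroredFamily A B ⊗ₘ pairingFamily B X) ≫ (λ_ _).hom =
    𝟙 _ ⊗≫ dual A ◁ (β_ (dual B ⊗ B) A).inv ▷ (dual X ⊗ X) ⊗≫
      dual A ◁ actFamily B (A ⊗ dual X) ▷ X ⊗≫ dual A ◁ A ◁ ev X ⊗≫ ev A := by
  calc
    _ = 𝟙 _ ⊗≫ dual A ◁ ((A ⊗ dual B) ◁ coev B ≫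
            ((β_ (dual B) A).inv ≫ (β_ A (dual B)).inv) ▷ (B ⊗ dual B)) ▷ (B ⊗ dual X ⊗ X) ⊗≫
          (dual A ⊗ A) ◁ (ev B) ▷ ((dual B ⊗ B) ⊗ (dual X ⊗ X)) ⊗≫
          (ev A ▷ ((dual B ⊗ B) ⊗ (dual X ⊗ X)) ≫ 𝟙_ C ◁ pairingFamily B X) ⊗≫ 𝟙 _ := by
      rw [comulFamily, mirroredFamily, MonoidalCategory.tensorHom_def,
        MonoidalCategory.tensorHom_def' (ev A)]
      monoidal
    _ = 𝟙 _ ⊗≫ dual A ◁ ((β_ (dual B) A).inv ≫ (β_ A (dual B)).inv) ▷ (B ⊗ dual X ⊗ X) ⊗≫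
          (dual A ⊗ A) ◁ (dual B ◁ coev B ⊗≫ ev B ▷ dual B) ▷ (B ⊗ dual X ⊗ X) ⊗≫
          (dual A ⊗ A) ◁ pairingFamily B X ⊗≫ ev A := by
      rw [← whisker_exchange (ev A), whisker_exchange ((β_ (dual B) A).inv ≫ _)]; monoidal
    _ = 𝟙 _ ⊗≫ dual A ◁ (𝟙 (A ⊗ (dual B ⊗ B) ⊗ dual X) ⊗≫
          ((β_ (dual B) A).inv ≫ (β_ A (dual B)).inv) ▷ (B ⊗ dual X) ⊗≫
          (A ⊗ dual B) ◁ monodromy B (dual X) ⊗≫ A ◁ ev B ▷ dual X ⊗≫ 𝟙 (A ⊗ dual X)) ▷ X ⊗≫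
          dual A ◁ A ◁ ev X ⊗≫ ev A := by
      rw [ExactPairing.coevaluation_evaluation'', pairingFamily,
        MonoidalCategory.tensorHom_def]
      monoidal
    _ = _ := by
      rw [← braiding_inv_actFamily]; monoidal

variable {L : Cowedge (coendBifunctor C)} (hL : IsColimit L)

lemma comp_comul_whiskerRight (Λ : 𝟙_ C ⟶ L.pt) {W : C} (f : W ⟶ L.pt) :
    f ≫ (λ_ _).inv ≫ (Λ ≫ comul hL) ▷ L.pt ≫ (α_ _ _ _).hom =
      (λ_ _).inv ≫ Λ ▷ W ≫ comul hL ▷ W ≫ (α_ _ _ _).hom ≫ L.pt ◁ L.pt ◁ f := by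
  rw [leftUnitor_inv_naturality_assoc, whisker_exchange_assoc]
  monoidal

end Link

/-! ### Computation of the composite with the Drinfeld map -/

section Ribbon

variable {C : Type u} [Category.{v} C] [MonoidalCategory C] [BraidedCategory C]
  [RightRigidCategory C] [RibbonCategory C] {L : Cowedge (coendBifunctor C)} (hL : IsColimit L)

/-- The transpose of `pivot X` is `rev X`, which is `ev X` up to an invertible twist and braiding,
so it separates morphisms. This passes from dual objects to all objects in `actEndo_app_eq_smul`. -/
instance mono_pivot (X : C) : Mono (pivot X) where
  right_cancellation {Z} f g h := by
    rw [← cancel_mono (RibbonCategory.twist X).hom]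
    apply hom_ext_ev
    rw [← cancel_epi (β_ Z (dual X)).hom, ← BraidedCategory.braiding_naturality_left_assoc,
      ← BraidedCategory.braiding_naturality_left_assoc, comp_whiskerRight_assoc,
      comp_whiskerRight_assoc]
    have := congrArg (fun t => t ▷ dual X ≫ ev (dual X)) h
    simpa only [comp_whiskerRight, Category.assoc, pivot_ev, rev] using this

lemma inj_mirroredPairing (X Y : C) :
    (inj L X ⊗ₘ inj L Y) ≫ mirroredPairing hL = mirroredFamily X Y := by
  rw [mirroredPairing, tensorHom_comp_whiskerLeft_assoc, inj_antipode,
    ← antipodeFamily_pairingFamily, ← inj_pairing hL, MonoidalCategory.tensorHom_def',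
    MonoidalCategory.tensorHom_def']
  simp

/-- The pairing `L ⊗ L ⟶ 𝟙` obtained by pairing the two factors with `Δ ∘ Λ`. -/
def linkPairing (Λ : 𝟙_ C ⟶ L.pt) : L.pt ⊗ L.pt ⟶ 𝟙_ C :=
  L.pt ◁ ((λ_ _).inv ≫ (Λ ≫ comul hL) ▷ L.pt ≫ (α_ _ _ _).hom) ≫ (α_ _ _ _).inv ≫
    (mirroredPairing hL ⊗ₘ pairing hL) ≫ (λ_ _).hom

lemma inj_comul_mirroredPairing_pairing (A X : C) :
    (dual A ⊗ A) ◁ (comul hL ▷ (dual X ⊗ X) ≫ (α_ _ _ _).hom) ≫ (α_ _ _ _).inv ≫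
      ((inj L A ▷ L.pt ≫ mirroredPairing hL) ⊗ₘ (L.pt ◁ inj L X ≫ pairing hL)) ≫ (λ_ _).hom =
    𝟙 _ ⊗≫ dual A ◁ (β_ L.pt A).inv ▷ (dual X ⊗ X) ⊗≫
      dual A ◁ act hL (A ⊗ dual X) ▷ X ⊗≫ dual A ◁ A ◁ ev X ⊗≫ ev A := by
  apply whiskerLeft_inj_hom_ext hL
  intro B
  have hl : (dual A ⊗ A) ◁ (inj L B ▷ (dual X ⊗ X)) ≫
      (dual A ⊗ A) ◁ (comul hL ▷ (dual X ⊗ X) ≫ (α_ _ _ _).hom) ≫ (α_ _ _ _).inv =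
      (dual A ⊗ A) ◁ (comulFamily B ▷ (dual X ⊗ X) ≫ (α_ _ _ _).hom) ≫ (α_ _ _ _).inv ≫
        ((dual A ⊗ A) ◁ inj L B ⊗ₘ inj L B ▷ (dual X ⊗ X)) := by
    rw [← whiskerLeft_comp_assoc, ← comp_whiskerRight_assoc, inj_comul,
      MonoidalCategory.tensorHom_def, MonoidalCategory.tensorHom_def]
    monoidal
  rw [reassoc_of% hl, tensorHom_comp_tensorHom_assoc, ← MonoidalCategory.tensorHom_def'_assoc,
    ← MonoidalCategory.tensorHom_def_assoc, inj_mirroredPairing, inj_pairing,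
    comulFamily_mirroredFamily_pairingFamily]
  symm
  calc
    _ = 𝟙 _ ⊗≫ dual A ◁ (A ◁ inj L B ≫ (β_ L.pt A).inv) ▷ (dual X ⊗ X) ⊗≫
          dual A ◁ act hL (A ⊗ dual X) ▷ X ⊗≫ dual A ◁ A ◁ ev X ⊗≫ ev A := by monoidal
    _ = 𝟙 _ ⊗≫ dual A ◁ (β_ (dual B ⊗ B) A).inv ▷ (dual X ⊗ X) ⊗≫
          dual A ◁ (inj L B ▷ (A ⊗ dual X) ≫ act hL (A ⊗ dual X)) ▷ X ⊗≫
          dual A ◁ A ◁ ev X ⊗≫ ev A := by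
      rw [BraidedCategory.braiding_inv_naturality_right]; monoidal
    _ = _ := by rw [inj_act]

/-- Once `Λ` is inserted, the inverse braiding of `L` past `A` becomes one with the unit and
disappears, leaving only the circle. -/
lemma inj_linkPairing (Λ : 𝟙_ C ⟶ L.pt) (A X : C) :
    (inj L A ⊗ₘ inj L X) ≫ linkPairing hL Λ =
      (α_ _ _ _).hom ≫ dual A ◁ partialEndo (actEndo hL Λ) A X ≫ ev A := by
  have h := (dual A ⊗ A) ◁ ((λ_ _).inv ≫ Λ ▷ (dual X ⊗ X)) ≫=
    inj_comul_mirroredPairing_pairing hL A X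
  have hl : (inj L A ⊗ₘ inj L X) ≫ L.pt ◁ ((λ_ _).inv ≫ (Λ ≫ comul hL) ▷ L.pt ≫
      (α_ _ _ _).hom) ≫ (α_ _ _ _).inv =
      (dual A ⊗ A) ◁ ((λ_ _).inv ≫ Λ ▷ (dual X ⊗ X)) ≫
      (dual A ⊗ A) ◁ (comul hL ▷ (dual X ⊗ X) ≫ (α_ _ _ _).hom) ≫ (α_ _ _ _).inv ≫
      (inj L A ▷ L.pt ⊗ₘ L.pt ◁ inj L X) := by
    rw [MonoidalCategory.tensorHom_def', Category.assoc, ← whisker_exchange_assoc,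
      ← whiskerLeft_comp_assoc, comp_comul_whiskerRight, MonoidalCategory.tensorHom_def']
    monoidal
  rw [← tensorHom_comp_tensorHom_assoc, ← reassoc_of% hl] at h
  rw [linkPairing, h]
  calc
    _ = 𝟙 _ ⊗≫ dual A ◁ (A ◁ Λ ≫ (β_ L.pt A).inv) ▷ (dual X ⊗ X) ⊗≫
          dual A ◁ act hL (A ⊗ dual X) ▷ X ⊗≫ dual A ◁ A ◁ ev X ⊗≫ ev A := by monoidal
    _ = _ := by
      rw [BraidedCategory.braiding_inv_naturality_right, braiding_inv_tensorUnit_left, partialEndo,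
        actEndo_app]
      monoidal

variable {E : Wedge (endBifunctor C)} (hE : IsLimit E)

lemma drinfeld_drinfeldInv (Λ : 𝟙_ C ⟶ L.pt) :
    drinfeld hL hE ≫ drinfeldInv hL E Λ =
      (λ_ _).inv ≫ (Λ ≫ comul hL) ▷ L.pt ≫ (α_ _ _ _).hom ≫ L.pt ◁ linkPairing hL Λ ≫
        (ρ_ _).hom := by
  unfold drinfeldInv linkPairing
  calc
    _ = 𝟙 _ ⊗≫ ((𝟙_ C ⊗ 𝟙_ C) ◁ drinfeld hL hE ≫ ((Λ ≫ comul hL) ⊗ₘ (Λ ≫ comul hL)) ▷ E.pt) ⊗≫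
          L.pt ◁ mirroredPairing hL ▷ (L.pt ⊗ E.pt) ⊗≫
          L.pt ◁ (dualProj hL E ▷ E.pt ≫ ev E.pt) ⊗≫ 𝟙 _ := by monoidal
    _ = 𝟙 _ ⊗≫ ((Λ ≫ comul hL) ⊗ₘ (Λ ≫ comul hL)) ▷ L.pt ⊗≫
          L.pt ◁ (((L.pt ⊗ L.pt) ⊗ L.pt) ◁ drinfeld hL hE ≫
            (mirroredPairing hL ▷ L.pt) ▷ E.pt) ⊗≫
          L.pt ◁ (dualProj hL E ▷ E.pt ≫ ev E.pt) ⊗≫ 𝟙 _ := by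
      rw [whisker_exchange]; monoidal
    _ = 𝟙 _ ⊗≫ ((Λ ≫ comul hL) ⊗ₘ (Λ ≫ comul hL)) ▷ L.pt ⊗≫
          L.pt ◁ (mirroredPairing hL ▷ L.pt) ▷ L.pt ⊗≫
          L.pt ◁ ((dualProj hL E ⊗ₘ drinfeld hL hE) ≫ ev E.pt) ⊗≫ 𝟙 _ := by
      rw [whisker_exchange, MonoidalCategory.tensorHom_def' (dualProj hL E)]; monoidal
    _ = _ := by
      rw [dualProj_drinfeld_ev, MonoidalCategory.tensorHom_def, MonoidalCategory.tensorHom_def]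
      monoidal

lemma comul_linkPairing (Λ : 𝟙_ C ⟶ L.pt) (X : C) :
    comul hL ▷ (dual X ⊗ X) ≫ (α_ _ _ _).hom ≫ L.pt ◁ (L.pt ◁ inj L X ≫ linkPairing hL Λ) ≫
      (ρ_ _).hom = slideMap hL (actEndo hL Λ) X := by
  apply inj_tensor_hom_ext hL
  intro A
  rw [inj_slideMap]
  calc
    _ = comulFamily A ▷ (dual X ⊗ X) ≫ (α_ _ _ _).hom ≫
          (dual A ⊗ A) ◁ ((inj L A ⊗ₘ inj L X) ≫ linkPairing hL Λ) ≫ (ρ_ _).hom ≫ inj L A := by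
      rw [← comp_whiskerRight_assoc, inj_comul, ← rightUnitor_naturality, whisker_exchange_assoc,
        MonoidalCategory.tensorHom_def, MonoidalCategory.tensorHom_def]
      monoidal
    _ = 𝟙 _ ⊗≫ dual A ◁ (coev A ▷ (A ⊗ dual X ⊗ X) ≫
          (A ⊗ dual A) ◁ partialEndo (actEndo hL Λ) A X) ⊗≫ (dual A ⊗ A) ◁ ev A ⊗≫ inj L A := by
      rw [inj_linkPairing, comulFamily]; monoidal
    _ = 𝟙 _ ⊗≫ dual A ◁ partialEndo (actEndo hL Λ) A X ⊗≫
          dual A ◁ (coev A ▷ A ⊗≫ A ◁ ev A) ⊗≫ inj L A := by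
      rw [← whisker_exchange]; monoidal
    _ = _ := by
      rw [ExactPairing.evaluation_coevaluation'']; monoidal

section Linear

variable {k : Type w} [Field k] [Preadditive C] [Linear k C] [MonoidalPreadditive C]
  [MonoidalLinear k C]

lemma actEndo_app_eq_smul {Λ : 𝟙_ C ⟶ L.pt} (hΛ : IsIntegral hL Λ) {Λco : L.pt ⟶ 𝟙_ C}
    (hΛco : IsCointegral hL Λco) (hnorm : Λ ≫ Λco = 𝟙 (𝟙_ C)) {ζ : k}
    (hζ : IsModularityParameter hL Λ Λco ζ) (U : C) :
    (actEndo hL Λ).app U = ζ • (endo Λco).app U := by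
  have key : ∀ Y : C, (actEndo hL Λ).app (dual Y) = ζ • (endo Λco).app (dual Y) := by
    intro Y
    apply dual_hom_ext
    rw [← inj_actEndo, hζ.2, Linear.comp_smul, hΛ.cointegral_eq hL hΛco hnorm hΛco, hnorm,
      Category.comp_id, MonoidalLinear.smul_whiskerRight, Linear.smul_comp]
  -- Naturality along `U ⟶ U^**` reduces the claim to a dual object.
  rw [← cancel_mono (pivot U), ← (actEndo hL Λ).naturality, key, Linear.comp_smul,
    (endo Λco).naturality, Linear.smul_comp]

theorem drinfeld_drinfeldInv_eq_smul {Λ : 𝟙_ C ⟶ L.pt} (hΛ : IsIntegral hL Λ) {Λco : L.pt ⟶ 𝟙_ C}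
    (hΛco : IsCointegral hL Λco) (hnorm : Λ ≫ Λco = 𝟙 (𝟙_ C)) {ζ : k}
    (hζ : IsModularityParameter hL Λ Λco ζ) :
    drinfeld hL hE ≫ drinfeldInv hL E Λ = ζ • 𝟙 L.pt := by
  have hs : ∀ X, slideMap hL (actEndo hL Λ) X = ζ • slideMap hL (endo Λco) X := by
    intro X
    apply inj_tensor_hom_ext hL
    intro A
    rw [Linear.comp_smul, inj_slideMap, inj_slideMap, partialEndo, partialEndo,
      actEndo_app_eq_smul hL hΛ hΛco hnorm hζ]
    simp
  apply inj_hom_ext hL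
  intro X
  rw [drinfeld_drinfeldInv, Linear.comp_smul, Category.comp_id]
  -- The `i_X` on the right is expanded as a slide over `Λ`, so that both sides are slides and `hs`
  -- compares them.
  nth_rw 2 [← hΛ.slideMap hL hΛco hnorm X]
  rw [← Linear.comp_smul, ← Linear.comp_smul, ← hs, ← comul_linkPairing, whiskerLeft_comp_assoc]
  have h := comp_comul_whiskerRight hL Λ (inj L X) =≫ (L.pt ◁ linkPairing hL Λ ≫ (ρ_ _).hom)
  simpa only [Category.assoc] using h

end Linear

end Ribbon

/-! ### Schur's lemma in a finite linear category -/

section Schur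

open scoped ModuleCat

lemma IsFiniteLinear.exists_smul_id {k : Type w} [Field k] [IsAlgClosed k]
    {C : Type u} [Category.{v} C] [Preadditive C] [Linear k C] (hfin : IsFiniteLinear k C)
    {X : C} [Simple X] (f : X ⟶ X) : ∃ c : k, c • 𝟙 X = f := by
  obtain ⟨A, _, _, _, e, _, _⟩ := hfin
  have : IsNoetherianRing A := isNoetherian_of_tower k (inferInstance : IsNoetherian k A)
  -- Kernels and finite-dimensional endomorphism spaces, the inputs of Schur's lemma, are
  -- transported from modules along the equivalence.
  have : HasLimitsOfShape WalkingParallelPair C := Adjunction.hasLimitsOfShape_of_equivalence e.functor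
  have : HasKernels C := inferInstance
  have : FiniteDimensional k (X ⟶ X) := by
    have h : FiniteDimensional k (e.functor.obj X ⟶ e.functor.obj X) := by
      have : Module.Finite k (e.functor.obj X).obj := Module.Finite.trans A _
      let g : (e.functor.obj X ⟶ e.functor.obj X) →ₗ[k]
          ((e.functor.obj X).obj →ₗ[k] (e.functor.obj X).obj) :=
        { toFun := fun f => f.hom.hom.restrictScalars k
          map_add' := fun _ _ => rfl
          map_smul' := fun _ _ => rfl }
      refine Module.Finite.of_injective g fun f₁ f₂ hf => ?_
      ext x
      exact LinearMap.congr_fun hf x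
    exact Module.Finite.of_injective (e.functor.mapLinearMap k) e.functor.map_injective
  exact endomorphism_simple_eq_smul_id k f

end Schur

end

end RibbonCoend

/-! ### The main theorem -/

theorem lemmaL {k : Type w} [Field k] [IsAlgClosed k]
    {C : Type u} [Category.{v} C] [Preadditive C] [Linear k C] [MonoidalCategory C]
    [MonoidalPreadditive C] [MonoidalLinear k C] [BraidedCategory C] [RightRigidCategory C]
    [RibbonCoend.RibbonCategory C]
    (hfin : RibbonCoend.IsFiniteLinear k C) (hsimple : Simple (𝟙_ C))
    (hunim : RibbonCoend.IsUnimodular C)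
    (L : Cowedge (RibbonCoend.coendBifunctor C)) (hL : IsColimit L)
    (E : Wedge (RibbonCoend.endBifunctor C)) (hE : IsLimit E)
    (Λ : 𝟙_ C ⟶ L.pt) (hΛ : RibbonCoend.IsIntegral hL Λ)
    (Λco : L.pt ⟶ 𝟙_ C) (hΛco : RibbonCoend.IsCointegral hL Λco)
    (hnorm : Λ ≫ Λco = 𝟙 (𝟙_ C)) :
    (∀ ζ : k, RibbonCoend.IsModularityParameter hL Λ Λco ζ →
      RibbonCoend.drinfeld hL hE ≫ RibbonCoend.drinfeldInv hL E Λ = ζ • 𝟙 L.pt) ∧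
    (RibbonCoend.IsNondegenerate (RibbonCoend.pairing hL) →
      ∃! ζ : k, RibbonCoend.IsModularityParameter hL Λ Λco ζ) := by
  refine ⟨fun ζ hζ => RibbonCoend.drinfeld_drinfeldInv_eq_smul hL hE hΛ hΛco hnorm hζ, fun hω => ?_⟩
  have hid : 𝟙 (𝟙_ C) ≠ 0 := id_nonzero _
  have hΛ₀ : Λ ≠ 0 := fun h => hid (by rw [← hnorm, h, zero_comp])
  have hΛco₀ : Λco ≠ 0 := fun h => hid (by rw [← hnorm, h, comp_zero])
  set f : L.pt ⟶ 𝟙_ C := (λ_ L.pt).inv ≫ Λ ▷ L.pt ≫ RibbonCoend.pairing hL with hf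
  have hf₀ : f ≠ 0 := hω.ne_zero hL hΛ₀
  -- The parameter can only be the scalar `f ∘ Λ`, since `Λco ∘ Λ = 1`.
  obtain ⟨ζ, hζ⟩ := hfin.exists_smul_id (Λ ≫ f)
  have hfζ : f = ζ • Λco := by
    apply RibbonCoend.inj_hom_ext hL
    intro X
    rw [hΛ.cointegral_eq hL hΛco hnorm (hΛ.isCointegral_pairing hL hω), ← hf, ← hζ,
      Linear.comp_smul, Linear.comp_smul, hΛ.cointegral_eq hL hΛco hnorm hΛco, hnorm]
  refine ⟨ζ, ⟨fun h => hf₀ (by rw [hfζ, h, zero_smul]), hfζ⟩, fun ζ' hζ' => ?_⟩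
  exact smul_left_injective k hΛco₀ (hζ'.2.symm.trans hfζ)
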